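/- Let $\mathbb K$ be a field with a valuation $\mathrm{val}:\mathbb K\to\mathbb R\cup\{-\infty\}$ (max-convention: $\mathrm{val}(ab)=\mathrm{val}(a)+\mathrm{val}(b)$, $\mathrm{val}(a+b)\le\max(\mathrm{val}(a),\mathrm{val}(b))$, $\mathrm{val}(a)=-\infty$ iff $a=0$). Let $F(x,y)=\sum_{(i,j)\in\mathcal A}a_{ij}x^iy^j$ be a Laurent polynomial with finite exponent set $\mathcal A\subset\mathbb Z^2$ and all $a_{ij}\in\mathbb K^*$, let $C$ be the curve $F=0$, let $p=(p_1,p_2)\in(\mathbb K^*)^2$, and suppose that $p$ has multiplicity $\mu_p(C)=m$, i.e. $m$ is the largest integer with $F\in\langle x-p_1,y-p_2\rangle^m$. Suppose that $C$ is admissible: the lattice width $\omega(\mathcal A)=\min_{u\in\mathbb Z^2\setminus\{0\}}\max_{s,t\in\mathcal A}u\cdot(s-t)$ is at least $m$. Let $\mathrm{Val}(C)\subset\mathbb R^2$ be the tropical curve of $F$, i.e. the set of points $(X,Y)$ at which the maximum $\max_{(i,j)\in\mathcal A}(iX+jY+\mathrm{val}(a_{ij}))$ is attained at least twice. Consider the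 regular subdivision of the Newton polygon $\mathrm{ConvexHull}(\mathcal A)$ that is dual to $\mathrm{Val}(C)$: a vertex or an edge $\sigma$ of $\mathrm{Val}(C)$ is dual to the face, respectively edge, $d(\sigma)$, which is the convex hull of those $(i,j)\in\mathcal A$ whose monomials are maximal at all points of $\sigma$. An edge of the subdivision is called dependent on a point $Q\in \mathrm{Val}(C)$ if it is $d(E')$ for an edge $E'$ of $\mathrm{Val}(C)$ such that the line spanned by $E'$ passes through $Q$. Assume that $P=(\mathrm{val}(p_1),\mathrm{val}(p_2))$ belongs to an edge $E$ of $\mathrm{Val}(C)$ and is not a vertex of $\mathrm{Val}(C)$. Then $\mathfrak{Infl}(P)\ge \frac{m^2}{2}$, where $\mathfrak{Infl}(P)$ is the sum of the areas of the faces of the subdivision that are incident to at least one edge dependent on $P$. Moreover, the dual edge $d(E)$ has integer length (number of its integer points minus one) at least $m$. -/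

import Mathlib

noncomputable section

namespace TropCurve

/-- Laurent polynomials in two variables over `K`: a polynomial `F` is the finite sum of its
monomials `F.coeff (i, j) * x ^ i * y ^ j`.  The curve `C` is given by `F = 0`. -/
abbrev Laurent (K : Type*) [Field K] : Type _ := AddMonoidAlgebra K (ℤ × ℤ)

/-- The set `𝒜` of the exponents of `F`, whose coefficients are not zero. -/
abbrev exponents {K : Type*} [Field K] (F : Laurent K) : Finset (ℤ × ℤ) := F.coeff.support

/-- The inclusion of the lattice `ℤ²` in the plane `ℝ²`. -/
def toPlane (s : ℤ × ℤ) : ℝ × ℝ := ((s.1 : ℝ), (s.2 : ℝ))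

/-! ### Lattice width and integer length -/

/-- The lattice width `max_{x, y ∈ B} u · (x - y)` of a finite set `B` in the direction `u`
(the maximum is not negative, since `x = y` is allowed). -/
def widthDir (B : Finset (ℤ × ℤ)) (u : ℤ × ℤ) : ℕ :=
  (B ×ˢ B).sup fun xy => (u.1 * (xy.1.1 - xy.2.1) + u.2 * (xy.1.2 - xy.2.2)).toNat

/-- The minimal lattice width: the minimum of the widths in all nonzero directions. -/
def latticeWidth (B : Finset (ℤ × ℤ)) : ℕ :=
  sInf {w : ℕ | ∃ u : ℤ × ℤ, u ≠ 0 ∧ w = widthDir B u}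

/-- The integer length of a lattice segment: the number of its lattice points minus one. -/
def integerLength (I : Set (ℝ × ℝ)) : ℕ :=
  {z : ℤ × ℤ | toPlane z ∈ I}.ncard - 1

variable {K : Type*} [Field K]

/-! ### Points and their multiplicity -/

/-- The ideal `⟨x - p₁, y - p₂⟩` of the point `p` of the torus in the ring of Laurent
polynomials. -/
def pointIdeal (p : Kˣ × Kˣ) : Ideal (Laurent K) :=
  Ideal.span
    {AddMonoidAlgebra.single ((1, 0) : ℤ × ℤ) (1 : K) - AddMonoidAlgebra.single 0 (p.1 : K),
     AddMonoidAlgebra.single ((0, 1) : ℤ × ℤ) (1 : K) - AddMonoidAlgebra.single 0 (p.2 : K)}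

/-- `μ_p(C) = m`: the largest power of the (maximal) ideal of `p` that contains `F` is the
`m`-th, that is, the Taylor expansion of `F` at `p` starts in degree `m`. -/
def HasMultiplicity (F : Laurent K) (p : Kˣ × Kˣ) (m : ℕ) : Prop :=
  F ∈ pointIdeal p ^ m ∧ F ∉ pointIdeal p ^ (m + 1)

/-! ### The tropical curve

A valuation `v : Valuation K (WithZero (Multiplicative ℝ))` is the same as a map `val : K → ℝ ∪ {-∞}` with
`val (a * b) = val a + val b`, `val (a + b) ≤ max (val a) (val b)`, where `-∞` is the zero of
`WithZero (Multiplicative ℝ)`; then `val (a + b) = max (val a) (val b)` if `val a ≠ val b`.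
The valuation need not be surjective, and `K` need not be algebraically closed. -/

variable (v : Valuation K (WithZero (Multiplicative ℝ)))

/-- The real number `val a`, for `a ≠ 0`. -/
def val (a : K) : ℝ := WithZero.log (v a)

/-- `Val(p) = (val p₁, val p₂)`. -/
def valPoint (p : Kˣ × Kˣ) : ℝ × ℝ := (val v (p.1 : K), val v (p.2 : K))

variable (F : Laurent K)

/-- The value `i * X + j * Y + val a_{ij}` at `Q = (X, Y)` of the tropical monomial with exponent
`s = (i, j)`. -/
def tropMonomial (s : ℤ × ℤ) (Q : ℝ × ℝ) : ℝ :=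
  (s.1 : ℝ) * Q.1 + (s.2 : ℝ) * Q.2 + val v (F.coeff s)

open scoped Classical in
/-- The exponents of `F` whose tropical monomials attain the maximum
`Val(F)(Q) = max_{(i, j)} (i * X + j * Y + val a_{ij})` at the point `Q`. -/
def maximizers (Q : ℝ × ℝ) : Finset (ℤ × ℤ) :=
  (exponents F).filter fun s => ∀ t ∈ exponents F, tropMonomial v F t Q ≤ tropMonomial v F s Q

/-- The tropical curve `Val(C)`: the points where the maximum `Val(F)` is attained at least
twice. -/
def tropicalCurve : Set (ℝ × ℝ) := {Q | (maximizers v F Q).Nontrivial}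

/-- The polygon, segment or point spanned by a finite set of exponents. -/
def cellHull (S : Finset (ℤ × ℤ)) : Set (ℝ × ℝ) := convexHull ℝ (toPlane '' (S : Set (ℤ × ℤ)))

/-- A vertex of `Val(C)`: a point where monomials with non-collinear exponents are maximal. -/
def IsVertex (Q : ℝ × ℝ) : Prop :=
  ¬ Collinear ℝ (toPlane '' (maximizers v F Q : Set (ℤ × ℤ)))

/-- An edge of `Val(C)` (a closed segment, ray or line): the set of all points where all
monomials are maximal that are maximal at some point `Q` of `Val(C)` which is not a vertex. -/
def IsEdge (E : Set (ℝ × ℝ)) : Prop :=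
  ∃ Q ∈ tropicalCurve v F, ¬ IsVertex v F Q ∧ E = {R | maximizers v F Q ⊆ maximizers v F R}

/-! ### The dual subdivision of the Newton polygon

The extended Newton polyhedron is the convex hull of the rays
`{(i, j, z) | z ≤ val a_{ij}}`.  Its face on which `i * X + j * Y + z` is maximal projects onto the
hull of `maximizers v F (X, Y)`, so that these hulls are the cells of the subdivision.  A cell is
recorded by its set of exponents. -/

open scoped Classical in
/-- The dual cell `d(E)`: the exponents of the monomials that are maximal everywhere on `E`. -/
def dualCell (E : Set (ℝ × ℝ)) : Finset (ℤ × ℤ) :=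
  (exponents F).filter fun s => ∀ Q ∈ E, s ∈ maximizers v F Q

/-- The (two-dimensional) faces of the subdivision: the cells `d(Q)` dual to the vertices of
`Val(C)`. -/
def IsFace (S : Finset (ℤ × ℤ)) : Prop :=
  ∃ Q, IsVertex v F Q ∧ S = dualCell v F {Q}

/-- `dep(Q)`: the edges of `Val(C)` that span a line through `Q`. -/
def dep (Q : ℝ × ℝ) : Set (Set (ℝ × ℝ)) :=
  {E | IsEdge v F E ∧ Q ∈ affineSpan ℝ E}

/-- The edges `d(E)`, `E ∈ dep(Q)`, of the subdivision: those which are dependent on `Q`. -/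
def Dep (Q : ℝ × ℝ) : Set (Finset (ℤ × ℤ)) := dualCell v F '' dep v F Q

/-- The Euclidean area of the hull of a finite set of exponents. -/
def area (S : Finset (ℤ × ℤ)) : ℝ := (MeasureTheory.volume (cellHull S)).toReal

open scoped Classical in
/-- The influence of a point `Q` of `Val(C)` which is not a vertex: the sum of the areas of the
faces of the subdivision that are incident to at least one edge dependent on `Q`. -/
def influence (Q : ℝ × ℝ) : ℝ :=
  ∑ S ∈ (exponents F).powerset.filter
      (fun S => IsFace v F S ∧ ∃ T ∈ Dep v F Q, cellHull T ⊆ cellHull S), area S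

end TropCurve

end

/-! ### Arithmetic of a multiple point: linear relations among the monomials at p. -/

namespace TropCurve

/-! ### Functions of bounded degree on an abelian group -/

/-! If F lies in the m-th power of the ideal of p, then ∑ a_s p^s D(s) = 0 for every integer-valued
D on ℤ² of degree less than m (`weightedSum_eq_zero`). Integers have valuation at most 1, so D
cannot be 1 at one exponent s and 0 at all others whose monomials at P are at least as large
(`not_isolated`). Write λ for the tropical monomial values at P. Products of binomial coefficients
then show: if the superlevel set {λ ≥ λ_s} lies in a strip α ≤ u ≤ β, its row through s has extent
at least m - (β - α) (`row_extent`). The case α = β bounds the integer length of d(E).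

For the influence, let u be the primitive form constant on d(E), and measure heights from that row,
on which alone λ is maximal. Over a height t > 0 between the rows, a supporting line of slope -τ of
the points (height, λ) yields the cell dual to P + τu. Where the estimates are positive, this is a
face whose lowest row is an edge dependent on P, being dual to an edge along P + ℝu
(`maximizers_mem_influenceFaces`). Interpolating the extents of a row below t and a row above t, the
slice of the face at height t has length at least m - t - y, where -y is an average of the lowest
heights of the two superlevel sets.

A concave envelope M of λ controls this depth: the bound holds for all y > 0 with t + y < m and
M(-y) ≤ M(t), or with y beyond the lowest row (`le_volume_slice_influenceRegion`). Thus the slice at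
t is at least as long as the section at x = t of the part of the triangle x, y > 0, x + y < m where
M(-y) ≤ M(x). By symmetry the slices at -y account for the part where M(x) ≤ M(-y). Width at least m
in the direction u ensures that no point of the triangle lies beyond both extreme rows, so the parts
cover it, and integrating the slices gives m²/2 (`half_sq_le_volume`). -/

/-- The integer valued functions that are annihilated by any `n` difference operators. -/
def DegreeLT {G : Type*} [AddCommGroup G] : ℕ → (G → ℤ) → Prop
  | 0, f => f = 0
  | n + 1, f => ∀ a, DegreeLT n fun x => f (x + a) - f x

namespace DegreeLT

variable {G : Type*} [AddCommGroup G]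

theorem zero (n : ℕ) : DegreeLT n fun _ : G => (0 : ℤ) := by
  induction n with
  | zero => rfl
  | succ n ih => intro a; simpa only [sub_self] using ih

theorem succ {n : ℕ} {f : G → ℤ} (h : DegreeLT n f) : DegreeLT (n + 1) f := by
  induction n generalizing f with
  | zero => intro a; rw [show f = 0 from h]; exact zero 0
  | succ n ih => exact fun a => ih (h a)

theorem mono {n k : ℕ} (hnk : n ≤ k) {f : G → ℤ} (h : DegreeLT n f) : DegreeLT k f := by
  induction hnk with
  | refl => exact h
  | step _ ih => exact ih.succ

theorem add {n : ℕ} {f g : G → ℤ} (hf : DegreeLT n f) (hg : DegreeLT n g) :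
    DegreeLT n fun x => f x + g x := by
  induction n generalizing f g with
  | zero => funext x; simp [show f = 0 from hf, show g = 0 from hg]
  | succ n ih =>
    intro a
    convert ih (hf a) (hg a) using 2
    ring

theorem neg {n : ℕ} {f : G → ℤ} (hf : DegreeLT n f) : DegreeLT n fun x => -f x := by
  induction n generalizing f with
  | zero => funext x; simp [show f = 0 from hf]
  | succ n ih =>
    intro a
    convert ih (hf a) using 2
    ring

theorem translate {n : ℕ} {f : G → ℤ} (hf : DegreeLT n f) (b : G) :
    DegreeLT n fun x => f (x + b) := by
  induction n generalizing f with
  | zero => funext x; simp [show f = 0 from hf]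
  | succ n ih =>
    intro a
    convert ih (hf a) using 3
    abel_nf

theorem comp {H : Type*} [AddCommGroup H] {n : ℕ} {f : G → ℤ} (hf : DegreeLT n f) (φ : H →+ G) :
    DegreeLT n fun x => f (φ x) := by
  induction n generalizing f with
  | zero => funext x; simp [show f = 0 from hf]
  | succ n ih =>
    intro a
    convert ih (hf (φ a)) using 3
    dsimp only
    rw [map_add]

theorem mul {a b : ℕ} {f g : G → ℤ} (hf : DegreeLT (a + 1) f) (hg : DegreeLT (b + 1) g) :
    DegreeLT (a + b + 1) fun x => f x * g x := by
  induction hn : a + b generalizing a b f g with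
  | zero =>
    obtain ⟨rfl, rfl⟩ : a = 0 ∧ b = 0 := by omega
    intro c
    funext x
    have h₁ : f (x + c) - f x = 0 := congrFun (hf c) x
    have h₂ : g (x + c) - g x = 0 := congrFun (hg c) x
    dsimp only
    rw [Pi.zero_apply, sub_eq_zero.1 h₁, sub_eq_zero.1 h₂, sub_self]
  | succ n ih =>
    intro c
    have h₁ : DegreeLT (n + 1) fun x => f (x + c) * (g (x + c) - g x) := by
      rcases b with _ | b
      · convert zero (G := G) (n + 1) using 1
        funext x
        have h₂ : g (x + c) - g x = 0 := congrFun (hg c) x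
        simp [h₂]
      · exact ih (hf.translate c) (hg c) (by omega)
    have h₂ : DegreeLT (n + 1) fun x => (f (x + c) - f x) * g x := by
      rcases a with _ | a
      · convert zero (G := G) (n + 1) using 1
        funext x
        have h₂ : f (x + c) - f x = 0 := congrFun (hf c) x
        simp [h₂]
      · exact ih (hf c) hg (by omega)
    convert h₁.add h₂ using 2
    ring

/-- Pascal's rule handles the shift by 1; any other shift telescopes into unit shifts. -/
theorem choose (n : ℕ) : DegreeLT (n + 1) fun x : ℤ => Ring.choose x n := by
  induction n with
  | zero => intro a; funext x; simp
  | succ n ih =>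
    have h₁ : DegreeLT (n + 1) fun x : ℤ => Ring.choose (x + 1) (n + 1) - Ring.choose x (n + 1) := by
      convert ih using 2 with x
      rw [Ring.choose_succ_succ]
      ring
    intro a
    induction a using Int.induction_on with
    | zero => simpa only [add_zero, sub_self] using zero (G := ℤ) (n + 1)
    | succ k ihk =>
      convert ihk.add (h₁.translate k) using 2 with x
      rw [add_assoc]
      ring
    | pred k ihk =>
      convert ihk.add (h₁.translate (-k - 1)).neg using 2 with x
      rw [show x + (-(k : ℤ) - 1) + 1 = x + -k by ring]
      ring

end DegreeLT

variable {K : Type*} [Field K]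

/-! ### Linear conditions imposed by a multiple point -/

/-- The monomial `x ^ i * y ^ j` at the point `p`. -/
def monomialAt (p : Kˣ × Kˣ) (s : ℤ × ℤ) : K := (p.1 : K) ^ s.1 * (p.2 : K) ^ s.2

theorem monomialAt_add (p : Kˣ × Kˣ) (s t : ℤ × ℤ) :
    monomialAt p (s + t) = monomialAt p s * monomialAt p t := by
  simp only [monomialAt, Prod.fst_add, Prod.snd_add, zpow_add₀ p.1.ne_zero,
    zpow_add₀ p.2.ne_zero]
  ring

theorem monomialAt_ne_zero (p : Kˣ × Kˣ) (s : ℤ × ℤ) : monomialAt p s ≠ 0 :=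
  mul_ne_zero (zpow_ne_zero _ p.1.ne_zero) (zpow_ne_zero _ p.2.ne_zero)

/-- The sum of the values at `p` of the monomials of `F`, weighted by `D`. -/
def weightedSum (p : Kˣ × Kˣ) (D : ℤ × ℤ → ℤ) (F : Laurent K) : K :=
  F.coeff.sum fun s a => a * monomialAt p s * (D s : K)

theorem weightedSum_add (p : Kˣ × Kˣ) (D : ℤ × ℤ → ℤ) (F G : Laurent K) :
    weightedSum p D (F + G) = weightedSum p D F + weightedSum p D G := by
  unfold weightedSum
  rw [AddMonoidAlgebra.coeff_add, Finsupp.sum_add_index'] <;> intros <;> ring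

theorem weightedSum_single (p : Kˣ × Kˣ) (D : ℤ × ℤ → ℤ) (s : ℤ × ℤ) (a : K) :
    weightedSum p D (AddMonoidAlgebra.single s a) = a * monomialAt p s * (D s : K) := by
  unfold weightedSum
  rw [AddMonoidAlgebra.coeff_single, Finsupp.sum_single_index]
  ring

/-- Multiplication by a generator of the ideal of p becomes a difference of D. This replaces
derivatives at p in every characteristic. -/
theorem weightedSum_binomial_mul (p : Kˣ × Kˣ) (D : ℤ × ℤ → ℤ) (t : ℤ × ℤ) (F : Laurent K) :
    weightedSum p D ((AddMonoidAlgebra.single t 1 - AddMonoidAlgebra.single 0 (monomialAt p t)) * F)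
      = monomialAt p t * weightedSum p (fun s => D (s + t) - D s) F := by
  induction F using AddMonoidAlgebra.induction_linear with
  | zero => simp [weightedSum]
  | add F G hF hG => rw [mul_add, weightedSum_add, weightedSum_add, hF, hG, mul_add]
  | single s a =>
    rw [sub_eq_add_neg, ← AddMonoidAlgebra.single_neg, add_mul, weightedSum_add,
      AddMonoidAlgebra.single_mul_single, AddMonoidAlgebra.single_mul_single]
    simp only [weightedSum_single, zero_add, one_mul, add_comm t s, monomialAt_add]
    push_cast
    ring

theorem weightedSum_eq_zero {p : Kˣ × Kˣ} {m : ℕ} {D : ℤ × ℤ → ℤ} (hD : DegreeLT m D)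
    {F : Laurent K} (hF : F ∈ pointIdeal p ^ m) : weightedSum p D F = 0 := by
  induction m generalizing D F with
  | zero =>
    rw [show D = 0 from hD]
    simp [weightedSum]
  | succ m ih =>
    rw [pow_succ'] at hF
    induction hF using Submodule.mul_induction_on' with
    | add F _ G _ hF hG => rw [weightedSum_add, hF, hG, add_zero]
    | mem_mul_mem a ha G hG =>
      obtain ⟨b, c, rfl⟩ := Ideal.mem_span_pair.1 ha
      have h₁ := weightedSum_binomial_mul p D (1, 0) (b * G)
      have h₂ := weightedSum_binomial_mul p D (0, 1) (c * G)
      rw [ih (hD _) (Ideal.mul_mem_left _ _ hG), mul_zero] at h₁ h₂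
      simp only [monomialAt, zpow_one, zpow_zero, mul_one, one_mul] at h₁ h₂
      rw [show ∀ f g : Laurent K, (b * f + c * g) * G = f * (b * G) + g * (c * G) by
        intros; ring, weightedSum_add, h₁, h₂, add_zero]

/-! ### Rows of the superlevel sets -/

variable (v : Valuation K (WithZero (Multiplicative ℝ)))

theorem val_intCast_le_one (n : ℤ) : v (n : K) ≤ 1 := by
  induction n using Int.induction_on with
  | zero => simp
  | succ k ih =>
    push_cast at ih ⊢
    exact (v.map_add _ _).trans (max_le ih (by simp))
  | pred k ih =>
    push_cast at ih ⊢
    exact (v.map_sub _ _).trans (max_le ih (by simp))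

theorem tropMonomial_valPoint (F : Laurent K) (p : Kˣ × Kˣ) {s : ℤ × ℤ} (hs : s ∈ exponents F) :
    tropMonomial v F s (valPoint v p) = WithZero.log (v (F.coeff s * monomialAt p s)) := by
  have h₀ : v (F.coeff s) ≠ 0 := v.ne_zero_iff.2 (Finsupp.mem_support_iff.1 hs)
  have h₁ : v (p.1 : K) ≠ 0 := v.ne_zero_iff.2 p.1.ne_zero
  have h₂ : v (p.2 : K) ≠ 0 := v.ne_zero_iff.2 p.2.ne_zero
  simp only [tropMonomial, valPoint, val, monomialAt, map_mul, map_zpow₀]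
  rw [WithZero.log_mul h₀ (mul_ne_zero (zpow_ne_zero _ h₁) (zpow_ne_zero _ h₂)),
    WithZero.log_mul (zpow_ne_zero _ h₁) (zpow_ne_zero _ h₂), WithZero.log_zpow,
    WithZero.log_zpow, zsmul_eq_mul, zsmul_eq_mul]
  ring

/-- A function of degree less than the multiplicity cannot single out one exponent of a superlevel
set. -/
theorem not_isolated {F : Laurent K} {p : Kˣ × Kˣ} {m : ℕ} (hF : F ∈ pointIdeal p ^ m)
    {D : ℤ × ℤ → ℤ} (hD : DegreeLT m D) {s : ℤ × ℤ} (hs : s ∈ exponents F) (hDs : D s = 1)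
    (h : ∀ r ∈ exponents F, r ≠ s →
      tropMonomial v F s (valPoint v p) ≤ tropMonomial v F r (valPoint v p) → D r = 0) :
    False := by
  classical
  have hne : ∀ r ∈ exponents F, v (F.coeff r * monomialAt p r) ≠ 0 := fun r hr =>
    v.ne_zero_iff.2 (mul_ne_zero (Finsupp.mem_support_iff.1 hr) (monomialAt_ne_zero p r))
  have hsum := weightedSum_eq_zero hD hF
  rw [weightedSum, Finsupp.sum, ← Finset.add_sum_erase _ _ hs, hDs, Int.cast_one, mul_one] at hsum
  -- The term at s would strictly dominate a sum that vanishes.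
  have hlt : v (∑ r ∈ (exponents F).erase s, F.coeff r * monomialAt p r * (D r : K))
      < v (F.coeff s * monomialAt p s) := by
    refine v.map_sum_lt (hne s hs) fun r hr => ?_
    obtain ⟨hrs, hr⟩ := Finset.mem_erase.1 hr
    by_cases hle : tropMonomial v F s (valPoint v p) ≤ tropMonomial v F r (valPoint v p)
    · rw [h r hr hrs hle, Int.cast_zero, mul_zero, map_zero]
      exact zero_lt_iff.2 (hne s hs)
    · rw [tropMonomial_valPoint v F p hs, tropMonomial_valPoint v F p hr, not_le,
        WithZero.log_lt_log (hne r hr) (hne s hs)] at hle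
      rw [map_mul]
      exact (mul_le_of_le_one_right' (val_intCast_le_one v _)).trans_lt hle
  rw [eq_neg_of_add_eq_zero_left hsum, v.map_neg] at hlt
  exact lt_irrefl _ hlt

/-- The linear form `u` on the lattice. -/
def dot (u : ℤ × ℤ) : ℤ × ℤ →+ ℤ :=
  u.1 • AddMonoidHom.fst ℤ ℤ + u.2 • AddMonoidHom.snd ℤ ℤ

@[simp]
theorem dot_apply (u s : ℤ × ℤ) : dot u s = u.1 * s.1 + u.2 * s.2 := by
  simp [dot]

/-- The row of `s` in a superlevel set of width `β - α` has extent at least `m - (β - α)`. -/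
theorem row_extent {F : Laurent K} {p : Kˣ × Kˣ} {m : ℕ} (hF : F ∈ pointIdeal p ^ m)
    {u w : ℤ × ℤ} (huw : ∀ s t, dot u s = dot u t → dot w s = dot w t → s = t)
    {s : ℤ × ℤ} (hs : s ∈ exponents F) {α β : ℤ}
    (hαβ : ∀ r ∈ exponents F, tropMonomial v F s (valPoint v p) ≤
      tropMonomial v F r (valPoint v p) → α ≤ dot u r ∧ dot u r ≤ β) :
    ∃ r ∈ exponents F, ∃ r' ∈ exponents F,
      tropMonomial v F s (valPoint v p) ≤ tropMonomial v F r (valPoint v p) ∧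
      tropMonomial v F s (valPoint v p) ≤ tropMonomial v F r' (valPoint v p) ∧
      dot u r = dot u s ∧ dot u r' = dot u s ∧ m - (β - α) ≤ dot w r - dot w r' := by
  classical
  set row := (exponents F).filter fun r => dot u r = dot u s ∧
    tropMonomial v F s (valPoint v p) ≤ tropMonomial v F r (valPoint v p) with hrow
  have hsrow : s ∈ row := by simp [hrow, hs]
  obtain ⟨r, hr, hmax⟩ := Finset.exists_max_image row (dot w) ⟨s, hsrow⟩
  obtain ⟨r', hr', hmin⟩ := Finset.exists_min_image row (dot w) ⟨s, hsrow⟩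
  have hr₀ := Finset.mem_filter.1 hr
  have hr₀' := Finset.mem_filter.1 hr'
  refine ⟨r, hr₀.1, r', hr₀'.1, hr₀.2.2, hr₀'.2.2, hr₀.2.1, hr₀'.2.1, ?_⟩
  by_contra! hlt
  obtain ⟨hα, hβ⟩ := hαβ s hs le_rfl
  obtain ⟨a, ha⟩ := Int.eq_ofNat_of_zero_le (sub_nonneg.2 hα)
  obtain ⟨b, hb⟩ := Int.eq_ofNat_of_zero_le (sub_nonneg.2 hβ)
  obtain ⟨c, hc⟩ := Int.eq_ofNat_of_zero_le (sub_nonneg.2 (hmax r' hr'))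
  have hvanish : ∀ {n : ℕ} {x : ℤ}, 0 ≤ x → x < n → Ring.choose x n = 0 := by
    intro n x h0 hx
    lift x to ℕ using h0
    rw [Ring.choose_natCast, Nat.choose_eq_zero_of_lt (by exact_mod_cast hx)]
    rfl
  have hself : ∀ n : ℕ, Ring.choose (n : ℤ) n = 1 := by
    intro n
    rw [Ring.choose_natCast, Nat.choose_self]
    rfl
  -- The three factors vanish on the rows below s, on the rows above s, and on the rest of the row
  -- of r'. Binomial coefficients rather than powers give the value exactly 1 at r', whatever the
  -- residue characteristic. The degree is (β - α) + c < m.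
  have h₁ : DegreeLT (a + 1) fun x : ℤ × ℤ => Ring.choose (dot u x - α) a :=
    ((DegreeLT.choose a).translate (-α)).comp (dot u)
  have h₂ : DegreeLT (b + 1) fun x : ℤ × ℤ => Ring.choose (β - dot u x) b := by
    convert ((DegreeLT.choose b).translate β).comp (-dot u) using 3
    simp
    ring
  have h₃ : DegreeLT (c + 1) fun x : ℤ × ℤ => Ring.choose (dot w r - dot w x) c := by
    convert ((DegreeLT.choose c).translate (dot w r)).comp (-dot w) using 3
    simp
    ring
  refine not_isolated v hF (((h₁.mul h₂).mul h₃).mono (k := m) (by omega)) (s := r') hr₀'.1 ?_ ?_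
  · rw [hr₀'.2.1, ha, hb, hc, hself, hself, hself]
    rfl
  · intro t ht htr htle
    have hst := hr₀'.2.2.trans htle
    obtain ⟨hα', hβ'⟩ := hαβ t ht hst
    rcases lt_trichotomy (dot u t) (dot u s) with hlt' | heq | hgt
    · have := hvanish (n := a) (sub_nonneg.2 hα') (by omega)
      simp only [this, zero_mul]
    · have htrow : t ∈ row := Finset.mem_filter.2 ⟨ht, heq, hst⟩
      have hne : dot w t ≠ dot w r' := fun h => htr (huw _ _ (heq.trans hr₀'.2.1.symm) h)
      have h4 := hmin t htrow
      have := hvanish (n := c) (sub_nonneg.2 (hmax t htrow)) (by omega)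
      simp only [this, mul_zero]
    · have := hvanish (n := b) (sub_nonneg.2 hβ') (by omega)
      simp only [this, mul_zero, zero_mul]

end TropCurve

/-! ### Real analysis: concave envelopes and the area of a triangle. -/

namespace TropCurve

open MeasureTheory Set

/-! ### Concave envelopes of finitely many heights -/

/-- `M` bounds from above the heights `lam s` over the points `h s`, is concave with maximum at
`0`, and lies below a supporting line through two of the points. -/
structure IsEnvelope {ι : Type*} (A : Finset ι) (h lam : ι → ℝ) (M : ℝ → ℝ) : Prop where
  continuous : Continuous M
  concaveOn : ConcaveOn ℝ univ M
  zero_nonneg : 0 ≤ M 0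
  neg_of_ne_zero : ∀ x, x ≠ 0 → M x < 0
  le_apply : ∀ s ∈ A, lam s ≤ M (h s)
  exists_support : ∀ t, (∀ s ∈ A, h s ≠ t) → (∃ s ∈ A, h s < t) → (∃ s ∈ A, t < h s) →
    ∃ τ c, (∀ r ∈ A, lam r + τ * h r ≤ c) ∧ (∃ s ∈ A, h s < t ∧ lam s + τ * h s = c) ∧
      (∃ s ∈ A, t < h s ∧ lam s + τ * h s = c) ∧ M t ≤ c - τ * t

/-- Transfers the argument for positive heights to negative ones, where u is replaced by -u. -/
theorem IsEnvelope.comp_neg {ι : Type*} {A : Finset ι} {h lam : ι → ℝ} {M : ℝ → ℝ}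
    (hM : IsEnvelope A h lam M) : IsEnvelope A (fun s => -h s) lam fun x => M (-x) where
  continuous := hM.continuous.comp continuous_neg
  concaveOn := by
    refine ⟨convex_univ, fun x _ y _ a b ha hb hab => ?_⟩
    have := hM.concaveOn.2 (mem_univ (-x)) (mem_univ (-y)) ha hb hab
    convert this using 2
    simp only [smul_eq_mul]
    ring
  zero_nonneg := by simpa using hM.zero_nonneg
  neg_of_ne_zero x hx := hM.neg_of_ne_zero (-x) (neg_ne_zero.2 hx)
  le_apply s hs := by simpa using hM.le_apply s hs
  exists_support t ht := by
    rintro ⟨s, hs, hst⟩ ⟨s', hs', hst'⟩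
    obtain ⟨τ, c, hc, ⟨r, hr, hrt, hrc⟩, ⟨r', hr', hrt', hrc'⟩, hMt⟩ :=
      hM.exists_support (-t) (fun s hs hst => ht s hs (by linarith)) ⟨s', hs', by linarith⟩
        ⟨s, hs, by linarith⟩
    exact ⟨-τ, c, fun r hr => by simpa using hc r hr, ⟨r', hr', by linarith, by linarith⟩,
      ⟨r, hr, by linarith, by linarith⟩, by linarith⟩

theorem IsEnvelope.lt_of_lt {ι : Type*} {A : Finset ι} {h lam : ι → ℝ} {M : ℝ → ℝ}
    (hM : IsEnvelope A h lam M) {y b : ℝ} (hy : 0 ≤ y) (hyb : y < b) : M (-b) < M (-y) := by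
  have hb : 0 < b := hy.trans_lt hyb
  have h₁ := hM.concaveOn.2 (mem_univ 0) (mem_univ (-b)) 
    (sub_nonneg.2 ((div_le_one hb).2 hyb.le)) (div_nonneg hy hb.le) (sub_add_cancel 1 (y / b))
  simp only [smul_eq_mul, mul_zero, zero_add] at h₁
  rw [mul_neg, div_mul_cancel₀ _ hb.ne'] at h₁
  have h₂ := hM.neg_of_ne_zero (-b) (by linarith)
  have h₃ : y / b < 1 := (div_lt_one hb).2 hyb
  have h₄ := mul_nonneg (sub_nonneg.2 h₃.le) hM.zero_nonneg
  nlinarith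

/-- Among the chords joining a point left of t to a point right of t, take the highest one over t. A
point above its line would give a higher chord. -/
theorem exists_supporting_line {ι : Type*} (A : Finset ι) (h lam : ι → ℝ) {t : ℝ}
    (ht : ∀ s ∈ A, h s ≠ t) (hl : ∃ s ∈ A, h s < t) (hr : ∃ s ∈ A, t < h s) :
    ∃ s ∈ A, ∃ s' ∈ A, h s < t ∧ t < h s' ∧ ∀ r ∈ A,
      lam r + -((lam s' - lam s) / (h s' - h s)) * h r ≤
        lam s + -((lam s' - lam s) / (h s' - h s)) * h s := by
  classical
  obtain ⟨a, ha, hat⟩ := hl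
  obtain ⟨b, hb, hbt⟩ := hr
  obtain ⟨⟨s, s'⟩, hss, hmax⟩ := Finset.exists_max_image
    ((A ×ˢ A).filter fun q => h q.1 < t ∧ t < h q.2)
    (fun q => lam q.1 + (lam q.2 - lam q.1) / (h q.2 - h q.1) * (t - h q.1))
    ⟨(a, b), by simp [ha, hb, hat, hbt]⟩
  simp only [Finset.mem_filter, Finset.mem_product] at hss hmax
  obtain ⟨⟨hs, hs'⟩, hst, hst'⟩ := hss
  refine ⟨s, hs, s', hs', hst, hst', fun r hrA => ?_⟩
  set k := (lam s' - lam s) / (h s' - h s) with hk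
  have hk' : lam s' = lam s + k * (h s' - h s) := by
    rw [hk, div_mul_cancel₀ _ (by linarith)]
    ring
  by_contra! hlt
  rcases lt_or_gt_of_ne (ht r hrA) with hrt | hrt
  · have h₁ := hmax (r, s') ⟨⟨hrA, hs'⟩, hrt, hst'⟩
    dsimp only at h₁
    have hd : 0 < h s' - h r := by linarith
    rw [div_mul_eq_mul_div, ← sub_nonneg, ← sub_sub, sub_nonneg, div_le_iff₀ hd, hk'] at h₁
    nlinarith
  · have h₁ := hmax (s, r) ⟨⟨hs, hrA⟩, hst, hrt⟩
    dsimp only at h₁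
    have hd : 0 < h r - h s := by linarith
    rw [div_mul_eq_mul_div, ← sub_nonneg, ← sub_sub, sub_nonneg, div_le_iff₀ hd] at h₁
    nlinarith

theorem exists_isEnvelope {ι : Type*} (A : Finset ι) (h lam : ι → ℝ)
    (h₀ : ∃ s ∈ A, h s = 0 ∧ lam s = 0) (hle : ∀ s ∈ A, lam s ≤ 0)
    (hlt : ∀ s ∈ A, h s ≠ 0 → lam s < 0) : ∃ M, IsEnvelope A h lam M := by
  classical
  obtain ⟨s₀, hs₀, hh₀, hl₀⟩ := h₀
  have hA : A.Nonempty := ⟨s₀, hs₀⟩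
  have hev : ∀ᶠ ε in nhdsWithin (0 : ℝ) (Ioi 0), ∀ s ∈ A,
      lam s + ε * h s ≤ 0 ∧ lam s + -ε * h s ≤ 0 := by
    refine (Filter.eventually_all_finset A).2 fun s hs => ?_
    by_cases hh : h s = 0
    · simpa [hh] using hle s hs
    · have h₁ : Filter.Tendsto (fun ε => lam s + ε * h s) (nhds 0) (nhds (lam s)) := by
        have : Continuous fun ε => lam s + ε * h s := by fun_prop
        simpa using this.tendsto 0
      have h₂ : Filter.Tendsto (fun ε => lam s + -ε * h s) (nhds 0) (nhds (lam s)) := by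
        have : Continuous fun ε => lam s + -ε * h s := by fun_prop
        simpa using this.tendsto 0
      filter_upwards [nhdsWithin_le_nhds (h₁.eventually_lt_const (hlt s hs hh)),
        nhdsWithin_le_nhds (h₂.eventually_lt_const (hlt s hs hh))] with ε h₃ h₄
      exact ⟨h₃.le, h₄.le⟩
  obtain ⟨ε, hε, hεpos⟩ := (hev.and self_mem_nhdsWithin).exists
  set g : ℝ → ℝ := fun τ => A.sup' hA fun s => lam s + τ * h s with hg
  -- M is the minimum of finitely many supporting lines. The chord slopes provide the supports; the
  -- slopes ±ε, with ε so small that both lines still support at 0, force M < 0 away from 0.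
  set S : Finset ℝ := insert ε (insert (-ε) ((A ×ˢ A).image fun q =>
    -((lam q.2 - lam q.1) / (h q.2 - h q.1)))) with hS
  have hSne : S.Nonempty := ⟨ε, by simp [hS]⟩
  have hgle : ∀ τ, ∀ s ∈ A, lam s + τ * h s ≤ g τ := fun τ s hs =>
    Finset.le_sup' (fun s => lam s + τ * h s) hs
  set M : ℝ → ℝ := fun x => S.inf' hSne fun τ => g τ - τ * x with hM
  have hMle : ∀ x, ∀ τ ∈ S, M x ≤ g τ - τ * x := fun x τ hτ =>
    Finset.inf'_le (fun τ => g τ - τ * x) hτ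
  have hleM : ∀ s ∈ A, lam s ≤ M (h s) := fun s hs =>
    Finset.le_inf' _ _ fun τ _ => by linarith [hgle τ s hs]
  refine ⟨M, ?_, ⟨convex_univ, ?_⟩, ?_, ?_, hleM, ?_⟩
  · exact Continuous.finset_inf'_apply hSne fun τ _ => by fun_prop
  · intro x _ y _ a b ha hb hab
    refine Finset.le_inf' _ _ fun τ hτ => ?_
    have h₁ := mul_le_mul_of_nonneg_left (hMle x τ hτ) ha
    have h₂ := mul_le_mul_of_nonneg_left (hMle y τ hτ) hb
    simp only [smul_eq_mul]
    have h₃ : a * g τ + b * g τ = g τ := by rw [← add_mul, hab, one_mul]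
    linarith
  · simpa [hh₀, hl₀] using hleM s₀ hs₀
  · intro x hx
    have hεpos' : 0 < ε := hεpos
    rcases lt_or_gt_of_ne hx with hx | hx
    · have h₁ := hMle x (-ε) (by simp [hS])
      have h₂ : g (-ε) ≤ 0 := Finset.sup'_le _ _ fun s hs => (hε s hs).2
      nlinarith
    · have h₁ := hMle x ε (by simp [hS])
      have h₂ : g ε ≤ 0 := Finset.sup'_le _ _ fun s hs => (hε s hs).1
      nlinarith
  · intro t ht hl hr
    obtain ⟨s, hs, s', hs', hst, hst', hmax⟩ := exists_supporting_line A h lam ht hl hr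
    have hτ : -((lam s' - lam s) / (h s' - h s)) ∈ S := by
      rw [hS]
      exact Finset.mem_insert_of_mem (Finset.mem_insert_of_mem
        (Finset.mem_image.2 ⟨(s, s'), Finset.mk_mem_product hs hs', rfl⟩))
    have hg : g (-((lam s' - lam s) / (h s' - h s))) ≤
        lam s + -((lam s' - lam s) / (h s' - h s)) * h s := Finset.sup'_le _ _ hmax
    refine ⟨_, _, hmax, ⟨s, hs, hst, rfl⟩, ⟨s', hs', hst', ?_⟩, ?_⟩
    · have hne : h s' - h s ≠ 0 := by linarith
      field_simp
      ring
    · linarith [hMle t _ hτ]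

/-! ### Comparison of a plane set with a triangle -/

theorem volume_triangle {m : ℝ} (hm : 0 ≤ m) :
    volume {q : ℝ × ℝ | 0 < q.1 ∧ 0 < q.2 ∧ q.1 + q.2 < m} = ENNReal.ofReal (m ^ 2 / 2) := by
  have h₁ : {q : ℝ × ℝ | 0 < q.1 ∧ 0 < q.2 ∧ q.1 + q.2 < m} =
      regionBetween (fun _ => 0) (fun x => m - x) (Ioc 0 m) := by
    ext ⟨x, y⟩
    simp only [regionBetween, mem_ofPred_eq, mem_Ioc, mem_Ioo]
    constructor
    · rintro ⟨hx, hy, hxy⟩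
      exact ⟨⟨hx, by linarith⟩, hy, by linarith⟩
    · rintro ⟨⟨hx, -⟩, hy, hxy⟩
      exact ⟨hx, hy, by linarith⟩
  have hint : IntervalIntegrable (fun x : ℝ => m - x) volume 0 m :=
    (by fun_prop : Continuous fun x : ℝ => m - x).intervalIntegrable 0 m
  rw [h₁, Measure.volume_eq_prod, volume_regionBetween_eq_integral (by simp)
    ((intervalIntegrable_iff_integrableOn_Ioc_of_le hm).1 hint) measurableSet_Ioc
    (fun x hx => by linarith [hx.2])]
  congr 1
  simp only [Pi.sub_apply, sub_zero]
  rw [← intervalIntegral.integral_of_le hm, intervalIntegral.integral_sub (by simp) (by simp)]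
  simp
  ring

/-- Such a set lies in the interval [a - L, a]. -/
theorem volume_le_of_forall_sub_le {S : Set ℝ} {a : ℝ} {L : ENNReal}
    (h : ∀ y ∈ S, y < a ∧ ENNReal.ofReal (a - y) ≤ L) : volume S ≤ L := by
  induction L with
  | top => exact le_top
  | coe l =>
    have hS : S ⊆ Icc (a - l) a := by
      intro y hy
      obtain ⟨hya, hyl⟩ := h y hy
      rw [← ENNReal.ofReal_coe_nnreal] at hyl
      have := (ENNReal.ofReal_le_ofReal_iff (NNReal.coe_nonneg l)).1 hyl
      exact ⟨by linarith, hya.le⟩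
    refine (measure_mono hS).trans ?_
    rw [Real.volume_Icc, sub_sub_cancel, ENNReal.ofReal_coe_nnreal]

/-- The part of the triangle that is compared with the rows `t > 0`. -/
def comparisonRegion (m T B : ℝ) (M : ℝ → ℝ) : Set (ℝ × ℝ) :=
  {q | (0 < q.1 ∧ 0 < q.2 ∧ q.1 + q.2 < m) ∧ q.1 < T ∧ (B ≤ q.2 ∨ M (-q.2) ≤ M q.1)}

theorem measurableSet_comparisonRegion {m T B : ℝ} {M : ℝ → ℝ} (hM : Continuous M) :
    MeasurableSet (comparisonRegion m T B M) := by
  have h : comparisonRegion m T B M = {q | 0 < q.1} ∩ {q | 0 < q.2} ∩ {q | q.1 + q.2 < m} ∩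
      {q | q.1 < T} ∩ ({q | B ≤ q.2} ∪ {q | M (-q.2) ≤ M q.1}) := by
    ext q
    simp only [comparisonRegion, mem_ofPred_eq, mem_inter_iff, mem_union]
    tauto
  rw [h]
  refine ((((measurableSet_lt ?_ ?_).inter (measurableSet_lt ?_ ?_)).inter
    (measurableSet_lt ?_ ?_)).inter (measurableSet_lt ?_ ?_)).inter
    ((measurableSet_le ?_ ?_).union (measurableSet_le ?_ ?_)) <;>
  exact Continuous.measurable (by fun_prop)

theorem volume_comparisonRegion_le {m T B : ℝ} {M : ℝ → ℝ} (hM : Continuous M)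
    {σ : ℝ → ENNReal} (hσ : ∀ᵐ t, ∀ y, (t, y) ∈ comparisonRegion m T B M →
      ENNReal.ofReal (m - t - y) ≤ σ t) :
    volume (comparisonRegion m T B M) ≤ ∫⁻ t in Ioi 0, σ t := by
  rw [Measure.volume_eq_prod, Measure.prod_apply (measurableSet_comparisonRegion hM),
    ← lintegral_indicator measurableSet_Ioi]
  refine lintegral_mono_ae ?_
  filter_upwards [hσ] with t ht
  by_cases h0 : 0 < t
  · rw [indicator_of_mem (mem_Ioi.2 h0)]
    refine volume_le_of_forall_sub_le (a := m - t) fun y hy => ⟨?_, ht y hy⟩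
    have := hy.1.2.2
    simp only at this
    linarith
  · rw [show Prod.mk t ⁻¹' comparisonRegion m T B M = ∅ by
      ext y
      simp [comparisonRegion, h0]]
    simp

theorem half_sq_le_volume {m T B : ℝ} (hm : 0 ≤ m) (hTB : m ≤ T + B) {M : ℝ → ℝ}
    (hM : Continuous M) {W : Set (ℝ × ℝ)} (hW : MeasurableSet W)
    (hpos : ∀ᵐ t, ∀ y, (t, y) ∈ comparisonRegion m T B M →
      ENNReal.ofReal (m - t - y) ≤ volume (Prod.mk t ⁻¹' W))
    (hneg : ∀ᵐ t, ∀ y, (t, y) ∈ comparisonRegion m B T (fun x => M (-x)) →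
      ENNReal.ofReal (m - t - y) ≤ volume (Prod.mk (-t) ⁻¹' W)) :
    ENNReal.ofReal (m ^ 2 / 2) ≤ volume W := by
  set R₁ := comparisonRegion m T B M
  set R₂ := comparisonRegion m B T fun x => M (-x)
  have hM' : Continuous fun x => M (-x) := hM.comp continuous_neg
  -- Comparing M(x) with M(-y) decides which part contains (x, y). If x ≥ T, then x + y < m ≤ T + B
  -- forces y < B, so the reflected part takes it.
  have hcover : {q : ℝ × ℝ | 0 < q.1 ∧ 0 < q.2 ∧ q.1 + q.2 < m} ⊆ R₁ ∪ Prod.swap ⁻¹' R₂ := by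
    rintro ⟨x, y⟩ hq
    have hq' := hq
    obtain ⟨hx, hy, hxy⟩ := hq'
    dsimp only at hx hy hxy
    by_cases h₁ : x < T ∧ (B ≤ y ∨ M (-y) ≤ M x)
    · exact Or.inl ⟨hq, h₁⟩
    · refine Or.inr ⟨⟨hy, hx, by simpa [add_comm] using hxy⟩, ?_⟩
      simp only [Prod.swap_prod_mk, neg_neg]
      rcases lt_or_ge x T with hxT | hxT
      · have h₂ : ¬ (B ≤ y ∨ M (-y) ≤ M x) := fun h => h₁ ⟨hxT, h⟩
        push Not at h₂
        exact ⟨h₂.1, Or.inr h₂.2.le⟩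
      · exact ⟨by linarith, Or.inl hxT⟩
  have hswap : volume (Prod.swap ⁻¹' R₂) = volume R₂ := by
    rw [Measure.volume_eq_prod, ← Measure.prod_swap, Measure.map_apply measurable_swap
      (measurable_swap (measurableSet_comparisonRegion hM')), ← preimage_comp, Prod.swap_swap_eq,
      preimage_id, Measure.prod_swap]
  rw [← volume_triangle hm]
  refine (measure_mono hcover).trans ((measure_union_le _ _).trans ?_)
  rw [hswap]
  refine (add_le_add (volume_comparisonRegion_le hM hpos)
    (volume_comparisonRegion_le hM' hneg)).trans ?_
  have hreflect : ∫⁻ t in Ioi 0, volume (Prod.mk (-t) ⁻¹' W) =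
      ∫⁻ t in Iio 0, volume (Prod.mk t ⁻¹' W) := by
    rw [← lintegral_indicator measurableSet_Ioi, ← lintegral_indicator measurableSet_Iio,
      ← lintegral_neg_eq_self (fun t => (Iio (0 : ℝ)).indicator
        (fun t => volume (Prod.mk t ⁻¹' W)) t)]
    refine lintegral_congr fun t => ?_
    simp [indicator]
  rw [hreflect, Measure.volume_eq_prod, Measure.prod_apply hW, ← lintegral_union measurableSet_Iio
    (Set.disjoint_left.2 fun x (hx : x ∈ Ioi (0 : ℝ)) hx' => lt_asymm (mem_Ioi.1 hx) (mem_Iio.1 hx'))]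
  exact setLIntegral_le_lintegral _ _

end TropCurve

/-! ### Geometry of the dual subdivision: faces, rows and areas. -/

namespace TropCurve

open MeasureTheory Set

variable {K : Type*} [Field K] (v : Valuation K (WithZero (Multiplicative ℝ))) (F : Laurent K)

/-! ### Cells and faces -/

theorem mem_maximizers {Q : ℝ × ℝ} {s : ℤ × ℤ} : s ∈ maximizers v F Q ↔
    s ∈ exponents F ∧ ∀ t ∈ exponents F, tropMonomial v F t Q ≤ tropMonomial v F s Q := by
  classical
  simp [maximizers]

theorem mem_dualCell {E : Set (ℝ × ℝ)} {s : ℤ × ℤ} : s ∈ dualCell v F E ↔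
    s ∈ exponents F ∧ ∀ Q ∈ E, s ∈ maximizers v F Q := by
  classical
  simp [dualCell]

theorem dualCell_singleton (Q : ℝ × ℝ) : dualCell v F {Q} = maximizers v F Q := by
  ext s
  rw [mem_dualCell]
  simp only [mem_singleton_iff, forall_eq]
  exact ⟨fun h => h.2, fun h => ⟨((mem_maximizers v F).1 h).1, h⟩⟩

theorem cellHull_mono {S T : Finset (ℤ × ℤ)} (h : S ⊆ T) : cellHull S ⊆ cellHull T :=
  convexHull_mono (image_mono (Finset.coe_subset.2 h))

theorem isCompact_cellHull (S : Finset (ℤ × ℤ)) : IsCompact (cellHull S) :=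
  (S.finite_toSet.image _).isCompact_convexHull ℝ

theorem toPlane_mem_cellHull {S : Finset (ℤ × ℤ)} {s : ℤ × ℤ} (hs : s ∈ S) :
    toPlane s ∈ cellHull S :=
  subset_convexHull ℝ _ (mem_image_of_mem _ hs)

theorem collinear_of_row {u : ℤ × ℤ} (hu : u ≠ 0) {S : Finset (ℤ × ℤ)} {k : ℤ}
    (h : ∀ s ∈ S, dot u s = k) : Collinear ℝ (toPlane '' (S : Set (ℤ × ℤ))) := by
  rcases S.eq_empty_or_nonempty with rfl | ⟨a, ha⟩
  · simp [collinear_empty]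
  rw [collinear_iff_of_mem (mem_image_of_mem toPlane (Finset.mem_coe.2 ha))]
  refine ⟨(-(u.2 : ℝ), (u.1 : ℝ)), ?_⟩
  rintro _ ⟨s, hs, rfl⟩
  have h₁ : dot u s = dot u a := (h s hs).trans (h a ha).symm
  simp only [dot_apply] at h₁
  have h₂ : (u.1 : ℝ) * s.1 + u.2 * s.2 = u.1 * a.1 + u.2 * a.2 := by exact_mod_cast h₁
  have hpos : (u.1 : ℝ) ^ 2 + (u.2 : ℝ) ^ 2 ≠ 0 := by
    intro h0
    refine hu (Prod.ext ?_ ?_)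
    · have : (u.1 : ℝ) = 0 := by nlinarith [sq_nonneg (u.1 : ℝ), sq_nonneg (u.2 : ℝ)]
      exact_mod_cast this
    · have : (u.2 : ℝ) = 0 := by nlinarith [sq_nonneg (u.1 : ℝ), sq_nonneg (u.2 : ℝ)]
      exact_mod_cast this
  refine ⟨(-(u.2 : ℝ) * (s.1 - a.1) + u.1 * (s.2 - a.2)) / ((u.1 : ℝ) ^ 2 + (u.2 : ℝ) ^ 2), ?_⟩
  ext
  · simp only [toPlane, vadd_eq_add, Prod.fst_add, Prod.smul_fst, smul_eq_mul]
    field_simp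
    linear_combination (u.1 : ℝ) * h₂
  · simp only [toPlane, vadd_eq_add, Prod.snd_add, Prod.smul_snd, smul_eq_mul]
    field_simp
    linear_combination (u.2 : ℝ) * h₂

theorem cross_eq_of_collinear {S : Finset (ℤ × ℤ)}
    (h : Collinear ℝ (toPlane '' (S : Set (ℤ × ℤ)))) {a b c : ℤ × ℤ} (ha : a ∈ S) (hb : b ∈ S)
    (hc : c ∈ S) : (b.1 - a.1) * (c.2 - a.2) = (b.2 - a.2) * (c.1 - a.1) := by
  rw [collinear_iff_of_mem (mem_image_of_mem toPlane (Finset.mem_coe.2 ha))] at h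
  obtain ⟨d, hd⟩ := h
  obtain ⟨x, hx⟩ := hd _ (mem_image_of_mem toPlane (Finset.mem_coe.2 hb))
  obtain ⟨y, hy⟩ := hd _ (mem_image_of_mem toPlane (Finset.mem_coe.2 hc))
  simp only [toPlane, vadd_eq_add, Prod.ext_iff, Prod.fst_add, Prod.snd_add, Prod.smul_fst,
    Prod.smul_snd, smul_eq_mul] at hx hy
  have : ((b.1 : ℝ) - a.1) * (c.2 - a.2) = (b.2 - a.2) * (c.1 - a.1) := by
    rw [hx.1, hx.2, hy.1, hy.2]
    ring
  exact_mod_cast this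

theorem tropMonomial_add_smul (s u : ℤ × ℤ) (Q : ℝ × ℝ) (τ : ℝ) :
    tropMonomial v F s (Q + τ • toPlane u) = tropMonomial v F s Q + τ * (dot u s : ℤ) := by
  simp only [tropMonomial, toPlane, Prod.fst_add, Prod.snd_add, Prod.smul_fst, Prod.smul_snd,
    smul_eq_mul, dot_apply]
  push_cast
  ring

open scoped Classical in
/-- The faces that are incident to an edge dependent on `Q`. -/
noncomputable def influenceFaces (Q : ℝ × ℝ) : Finset (Finset (ℤ × ℤ)) :=
  (exponents F).powerset.filter
    fun S => IsFace v F S ∧ ∃ T ∈ Dep v F Q, cellHull T ⊆ cellHull S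

/-- The union of the faces that are incident to an edge dependent on `Q`. -/
def influenceRegion (Q : ℝ × ℝ) : Set (ℝ × ℝ) :=
  ⋃ S ∈ influenceFaces v F Q, cellHull S

theorem isCompact_influenceRegion (Q : ℝ × ℝ) : IsCompact (influenceRegion v F Q) :=
  (influenceFaces v F Q).isCompact_biUnion fun S _ => isCompact_cellHull S

theorem volume_influenceRegion_le (Q : ℝ × ℝ) :
    volume (influenceRegion v F Q) ≤ ENNReal.ofReal (influence v F Q) := by
  refine (measure_biUnion_finset_le _ _).trans ?_
  rw [show influence v F Q = ∑ S ∈ influenceFaces v F Q, area S from rfl,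
    ENNReal.ofReal_sum_of_nonneg (f := area) fun S _ => ENNReal.toReal_nonneg]
  exact Finset.sum_le_sum fun S _ => by
    rw [area, ENNReal.ofReal_toReal (isCompact_cellHull S).measure_lt_top.ne]

/-- Just before the parameter `τ`, the maximal monomials on the line `Q + ℝ u` are those in the
lowest row of the cell dual to `Q + τ u`. -/
theorem eventually_maximizers_eq {Q : ℝ × ℝ} {u : ℤ × ℤ} {τ : ℝ} {s : ℤ × ℤ}
    (hs : s ∈ maximizers v F (Q + τ • toPlane u))
    (hmin : ∀ r ∈ maximizers v F (Q + τ • toPlane u), dot u s ≤ dot u r) :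
    ∀ᶠ τ' in nhdsWithin τ (Iio τ), ∀ r, r ∈ maximizers v F (Q + τ' • toPlane u) ↔
      r ∈ maximizers v F (Q + τ • toPlane u) ∧ dot u r = dot u s := by
  have hlt : ∀ᶠ τ' in nhdsWithin τ (Iio τ), ∀ r ∈ exponents F,
      ¬ (r ∈ maximizers v F (Q + τ • toPlane u) ∧ dot u r = dot u s) →
      tropMonomial v F r (Q + τ' • toPlane u) < tropMonomial v F s (Q + τ' • toPlane u) := by
    refine (Filter.eventually_all_finset _).2 fun r hr => ?_
    by_cases hrS : r ∈ maximizers v F (Q + τ • toPlane u)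
    · filter_upwards [self_mem_nhdsWithin] with τ' hτ' hne
      have hτ'' : τ' < τ := hτ'
      have h₁ : dot u s < dot u r := lt_of_le_of_ne (hmin r hrS) fun h => hne ⟨hrS, h.symm⟩
      have h₂ : ((dot u s : ℤ) : ℝ) < (dot u r : ℤ) := by exact_mod_cast h₁
      have h₃ := ((mem_maximizers v F).1 hs).2 r hr
      simp only [tropMonomial_add_smul] at h₃ ⊢
      nlinarith
    · have h₁ : tropMonomial v F r (Q + τ • toPlane u) < tropMonomial v F s (Q + τ • toPlane u) := by
        by_contra! hle
        exact hrS ((mem_maximizers v F).2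
          ⟨hr, fun t ht => (((mem_maximizers v F).1 hs).2 t ht).trans hle⟩)
      have hcont : ∀ r, Continuous fun τ' : ℝ => tropMonomial v F r (Q + τ' • toPlane u) := by
        intro r
        simp only [tropMonomial_add_smul]
        fun_prop
      filter_upwards [nhdsWithin_le_nhds
        (((hcont r).tendsto τ).eventually_lt ((hcont s).tendsto τ) h₁)] with τ' h₂ _
      exact h₂
  filter_upwards [hlt] with τ' h r
  have hsA := ((mem_maximizers v F).1 hs).1
  constructor
  · intro hr
    by_contra hne
    exact (h r ((mem_maximizers v F).1 hr).1 hne).not_ge (((mem_maximizers v F).1 hr).2 s hsA)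
  · rintro ⟨hr, hrs⟩
    refine (mem_maximizers v F).2 ⟨((mem_maximizers v F).1 hr).1, fun t ht => ?_⟩
    have h₁ := ((mem_maximizers v F).1 hr).2 s hsA
    have h₂ := ((mem_maximizers v F).1 hs).2 r ((mem_maximizers v F).1 hr).1
    have h₃ : tropMonomial v F r (Q + τ' • toPlane u) = tropMonomial v F s (Q + τ' • toPlane u) := by
      simp only [tropMonomial_add_smul, hrs] at h₁ h₂ ⊢
      linarith
    rw [h₃]
    by_cases htS : t ∈ maximizers v F (Q + τ • toPlane u) ∧ dot u t = dot u s
    · have h₄ := ((mem_maximizers v F).1 htS.1).2 s hsA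
      have h₅ := ((mem_maximizers v F).1 hs).2 t ht
      simp only [tropMonomial_add_smul, htS.2] at h₄ h₅ ⊢
      linarith
    · exact (h t ht htS).le

/-- Two points in the lowest row and one above it are not collinear, so the cell is a face. Its
lowest row is the cell of the points of Q + ℝu just before τ, hence dual to an edge whose line
passes through Q. -/
theorem maximizers_mem_influenceFaces {Q : ℝ × ℝ} {u : ℤ × ℤ} (hu : u ≠ 0) {τ : ℝ}
    {s r r' s' : ℤ × ℤ}
    (hs : s ∈ maximizers v F (Q + τ • toPlane u))
    (hmin : ∀ r ∈ maximizers v F (Q + τ • toPlane u), dot u s ≤ dot u r)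
    (hr : r ∈ maximizers v F (Q + τ • toPlane u)) (hrs : dot u r = dot u s)
    (hr' : r' ∈ maximizers v F (Q + τ • toPlane u)) (hrs' : dot u r' = dot u s) (hrr' : r ≠ r')
    (hs' : s' ∈ maximizers v F (Q + τ • toPlane u)) (hss' : dot u s < dot u s') :
    maximizers v F (Q + τ • toPlane u) ∈ influenceFaces v F Q := by
  classical
  have hev := eventually_maximizers_eq v F hs hmin
  -- Two parameters with the same maximizers: both points lie on one edge and span the line Q + ℝu,
  -- which meets Q at parameter 0.
  obtain ⟨τ₁, h₁, hτ₁⟩ := (hev.and self_mem_nhdsWithin).exists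
  have hτ₁' : τ₁ < τ := hτ₁
  obtain ⟨τ₂, h₂, hτ₂⟩ := (hev.and (Ioo_mem_nhdsLT hτ₁')).exists
  refine Finset.mem_filter.2 ⟨Finset.mem_powerset.2 fun t ht => ((mem_maximizers v F).1 ht).1,
    ⟨_, ?_, (dualCell_singleton v F _).symm⟩, ?_⟩
  · intro hcol
    have hcross := cross_eq_of_collinear hcol hr hr' hs'
    have h₃ : (r'.1 - r.1) * (dot u s' - dot u r) = 0 := by
      simp only [dot_apply] at hrs hrs' ⊢
      linear_combination u.2 * hcross + (s'.1 - r.1) * (hrs' - hrs)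
    have h₄ : (r'.2 - r.2) * (dot u s' - dot u r) = 0 := by
      simp only [dot_apply] at hrs hrs' ⊢
      linear_combination -u.1 * hcross + (s'.2 - r.2) * (hrs' - hrs)
    have hne : dot u s' - dot u r ≠ 0 := by omega
    refine hrr' (Prod.ext ?_ ?_)
    · have := (mul_eq_zero.1 h₃).resolve_right hne
      omega
    · have := (mul_eq_zero.1 h₄).resolve_right hne
      omega
  · set E : Set (ℝ × ℝ) :=
      {R | maximizers v F (Q + τ₁ • toPlane u) ⊆ maximizers v F R} with hE
    have hE₁ : Q + τ₁ • toPlane u ∈ E := Finset.Subset.refl _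
    have hE₂ : Q + τ₂ • toPlane u ∈ E := fun t ht => (h₂ t).2 ((h₁ t).1 ht)
    refine ⟨dualCell v F E, ⟨E, ⟨⟨Q + τ₁ • toPlane u, ?_, ?_, rfl⟩, ?_⟩, rfl⟩,
      cellHull_mono fun t ht => ((h₁ t).1 (((mem_dualCell v F).1 ht).2 _ hE₁)).1⟩
    · exact ⟨r, (h₁ r).2 ⟨hr, hrs⟩, r', (h₁ r').2 ⟨hr', hrs'⟩, hrr'⟩
    · exact not_not.2 (collinear_of_row hu fun t ht => ((h₁ t).1 ht).2)
    · have hmem := AffineMap.lineMap_mem_affineSpan_pair (k := ℝ) (-τ₁ / (τ₂ - τ₁))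
        (Q + τ₁ • toPlane u) (Q + τ₂ • toPlane u)
      have hne : τ₂ - τ₁ ≠ 0 := (sub_pos.2 hτ₂.1).ne'
      have heq : AffineMap.lineMap (Q + τ₁ • toPlane u) (Q + τ₂ • toPlane u)
          (-τ₁ / (τ₂ - τ₁)) = Q := by
        ext <;>
        · simp only [AffineMap.lineMap_apply, vsub_eq_sub, vadd_eq_add, Prod.fst_add,
            Prod.snd_add, Prod.fst_sub, Prod.snd_sub, Prod.smul_fst, Prod.smul_snd, smul_eq_mul]
          field_simp
          ring
      rw [heq] at hmem
      refine affineSpan_mono ℝ ?_ hmem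
      rintro R (rfl | rfl)
      exacts [hE₁, hE₂]

/-! ### Rows of the faces -/

/-- A row of the cell dual to `P + τ u`, where `τ > 0`, has extent at least `m` minus the width of
the superlevel set. -/
theorem face_row_extent {F : Laurent K} {p : Kˣ × Kˣ} {m : ℕ} (hF : F ∈ pointIdeal p ^ m)
    {u w : ℤ × ℤ} (huw : ∀ s t, dot u s = dot u t → dot w s = dot w t → s = t) {τ : ℝ}
    (hτ : 0 < τ) {s : ℤ × ℤ} (hs : s ∈ maximizers v F (valPoint v p + τ • toPlane u)) :
    ∃ b ∈ exponents F,
      tropMonomial v F s (valPoint v p) ≤ tropMonomial v F b (valPoint v p) ∧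
      (∀ r ∈ exponents F, tropMonomial v F s (valPoint v p) ≤ tropMonomial v F r (valPoint v p) →
        dot u b ≤ dot u r) ∧
      ∃ r ∈ maximizers v F (valPoint v p + τ • toPlane u),
      ∃ r' ∈ maximizers v F (valPoint v p + τ • toPlane u),
        dot u r = dot u s ∧ dot u r' = dot u s ∧
        m - (dot u s - dot u b) ≤ dot w r - dot w r' := by
  classical
  obtain ⟨hsA, hsmax⟩ := (mem_maximizers v F).1 hs
  simp only [tropMonomial_add_smul] at hsmax
  obtain ⟨b, hb, hbmin⟩ := Finset.exists_min_image ((exponents F).filter fun r =>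
    tropMonomial v F s (valPoint v p) ≤ tropMonomial v F r (valPoint v p)) (dot u)
    ⟨s, Finset.mem_filter.2 ⟨hsA, le_rfl⟩⟩
  obtain ⟨hbA, hsb⟩ := Finset.mem_filter.1 hb
  obtain ⟨r, hr, r', hr', hsr, hsr', hrow, hrow', hext⟩ := row_extent v hF huw hsA
    (α := dot u b) (β := dot u s) fun r hr hle => by
      refine ⟨hbmin r (Finset.mem_filter.2 ⟨hr, hle⟩), ?_⟩
      by_contra! hlt
      have h₁ : ((dot u s : ℤ) : ℝ) < (dot u r : ℤ) := by exact_mod_cast hlt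
      nlinarith [hsmax r hr]
  have hmem : ∀ r ∈ exponents F, tropMonomial v F s (valPoint v p) ≤
      tropMonomial v F r (valPoint v p) → dot u r = dot u s →
      r ∈ maximizers v F (valPoint v p + τ • toPlane u) := by
    intro r hr hle hrow
    refine (mem_maximizers v F).2 ⟨hr, fun t ht => ?_⟩
    simp only [tropMonomial_add_smul, hrow]
    linarith [hsmax t ht]
  exact ⟨b, hbA, hsb, fun r hr hle => hbmin r (Finset.mem_filter.2 ⟨hr, hle⟩), r,
    hmem r hr hsr hrow, r', hmem r' hr' hsr' hrow', hrow, hrow', hext⟩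

/-- The points of `W` in the row `t`, in the lattice coordinates `u - k`, `w`. -/
def slice (u w : ℤ × ℤ) (k : ℤ) (W : Set (ℝ × ℝ)) (t : ℝ) : Set ℝ :=
  {x | ∃ q ∈ W, (u.1 * q.1 + u.2 * q.2 - k : ℝ) = t ∧ (w.1 * q.1 + w.2 * q.2 : ℝ) = x}

theorem le_volume_slice {W : Set (ℝ × ℝ)} {S : Finset (ℤ × ℤ)} (hSW : cellHull S ⊆ W)
    {u w : ℤ × ℤ} {k : ℤ} {a a' b b' : ℤ × ℤ} (ha : a ∈ S) (ha' : a' ∈ S) (hb : b ∈ S)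
    (hb' : b' ∈ S) (haa' : dot u a' = dot u a) (hbb' : dot u b' = dot u b) {θ : ℝ}
    (hθ₀ : 0 ≤ θ) (hθ₁ : θ ≤ 1) {t : ℝ}
    (ht : (1 - θ) * ((dot u a : ℤ) - k) + θ * ((dot u b : ℤ) - k) = t) :
    ENNReal.ofReal ((1 - θ) * ((dot w a : ℤ) - (dot w a' : ℤ)) +
      θ * ((dot w b : ℤ) - (dot w b' : ℤ))) ≤ volume (slice u w k W t) := by
  set x := (1 - θ) * (dot w a : ℤ) + θ * (dot w b : ℤ) with hx
  set x' := (1 - θ) * (dot w a' : ℤ) + θ * (dot w b' : ℤ) with hx'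
  have hsub : Icc x' x ⊆ slice u w k W t := by
    intro z hz
    have hle : x' ≤ x := hz.1.trans hz.2
    have hz' : z ∈ segment ℝ x' x := by rwa [segment_eq_Icc hle]
    obtain ⟨c, d, hc, hd, hcd, rfl⟩ := hz'
    have hq := convex_convexHull ℝ _ (toPlane_mem_cellHull ha) (toPlane_mem_cellHull hb)
      (sub_nonneg.2 hθ₁) hθ₀ (sub_add_cancel 1 θ)
    have hq' := convex_convexHull ℝ _ (toPlane_mem_cellHull ha') (toPlane_mem_cellHull hb')
      (sub_nonneg.2 hθ₁) hθ₀ (sub_add_cancel 1 θ)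
    refine ⟨_, hSW (convex_convexHull ℝ _ hq' hq hc hd hcd), ?_, ?_⟩
    · have h₁ : ((dot u a' : ℤ) : ℝ) = (dot u a : ℤ) := by rw [haa']
      have h₂ : ((dot u b' : ℤ) : ℝ) = (dot u b : ℤ) := by rw [hbb']
      simp only [dot_apply] at ht h₁ h₂
      push_cast at ht h₁ h₂
      simp only [toPlane, Prod.fst_add, Prod.snd_add, Prod.smul_fst, Prod.smul_snd, smul_eq_mul]
      obtain rfl : c = 1 - d := by linarith
      linear_combination ht + (1 - d) * (1 - θ) * h₁ + (1 - d) * θ * h₂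
    · simp only [hx, hx', dot_apply, toPlane, Prod.fst_add, Prod.snd_add, Prod.smul_fst,
        Prod.smul_snd, smul_eq_mul]
      push_cast
      ring
  refine le_trans (le_of_eq ?_) (measure_mono hsub)
  rw [Real.volume_Icc]
  congr 1
  rw [hx, hx']
  ring

theorem le_volume_slice_influenceRegion {F : Laurent K} {p : Kˣ × Kˣ} {m : ℕ}
    (hF : F ∈ pointIdeal p ^ m) {u w : ℤ × ℤ} (hu : u ≠ 0)
    (huw : ∀ s t, dot u s = dot u t → dot w s = dot w t → s = t)
    {a : ℤ × ℤ} (ha : a ∈ exponents F)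
    (hrow : ∀ s ∈ exponents F, dot u s ≠ dot u a →
      tropMonomial v F s (valPoint v p) < tropMonomial v F a (valPoint v p))
    {M : ℝ → ℝ} (hM : IsEnvelope (exponents F) (fun s => ((dot u s : ℤ) : ℝ) - (dot u a : ℤ))
      (fun s => tropMonomial v F s (valPoint v p) - tropMonomial v F a (valPoint v p)) M)
    {T B : ℝ} (hT : ∃ s ∈ exponents F, T ≤ ((dot u s : ℤ) : ℝ) - (dot u a : ℤ))
    (hB : ∀ s ∈ exponents F, -(((dot u s : ℤ) : ℝ) - (dot u a : ℤ)) ≤ B)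
    {t y : ℝ} (ht : ∀ s ∈ exponents F, ((dot u s : ℤ) : ℝ) - (dot u a : ℤ) ≠ t)
    (hty : (t, y) ∈ comparisonRegion m T B M) :
    ENNReal.ofReal (m - t - y) ≤
      volume (slice u w (dot u a) (influenceRegion v F (valPoint v p)) t) := by
  set P := valPoint v p with hP
  set lam : ℤ × ℤ → ℝ := fun s => tropMonomial v F s P - tropMonomial v F a P with hlam
  set h : ℤ × ℤ → ℝ := fun s => ((dot u s : ℤ) : ℝ) - (dot u a : ℤ) with hh
  obtain ⟨⟨ht0, hy0, htym⟩, htT, hyB⟩ := hty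
  dsimp only at ht0 hy0 htym htT hyB
  have hha : h a = 0 := sub_self _
  have hlama : lam a = 0 := sub_self _
  obtain ⟨s₃, hs₃, hTs₃⟩ := hT
  obtain ⟨τ, c, hc, ⟨s₁, hs₁A, hs₁t, hs₁c⟩, ⟨s', hs'A, hs't, hs'c⟩, hMt⟩ :=
    hM.exists_support t ht ⟨a, ha, by simpa [hha] using ht0⟩ ⟨s₃, hs₃, htT.trans_le hTs₃⟩
  replace hc : ∀ r ∈ exponents F, lam r + τ * h r ≤ c := hc
  replace hs₁c : lam s₁ + τ * h s₁ = c := hs₁c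
  replace hs'c : lam s' + τ * h s' = c := hs'c
  replace hs₁t : h s₁ < t := hs₁t
  replace hs't : t < h s' := hs't
  -- The row of a lies under the supporting line, while s' is on it at positive height with a
  -- smaller value.
  have hτ : 0 < τ := by
    have h₁ : lam s' < 0 := sub_neg.2 (hrow s' hs'A fun he => by
      have : h s' = 0 := sub_eq_zero.2 (congrArg _ he)
      linarith)
    have h₂ := hc a ha
    rw [hha, hlama] at h₂
    have h₃ : 0 < τ * h s' := by linarith
    exact pos_of_mul_pos_left h₃ (by linarith)
  have hmax : ∀ r, r ∈ maximizers v F (P + τ • toPlane u) ↔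
      r ∈ exponents F ∧ lam r + τ * h r = c := by
    intro r
    rw [mem_maximizers]
    refine and_congr_right fun hr => ?_
    simp only [tropMonomial_add_smul]
    constructor
    · intro hle
      have h₁ := hle s' hs'A
      have h₂ := hc r hr
      simp only [hlam, hh] at h₁ h₂ hs'c ⊢
      linarith
    · intro he s hs
      have h₂ := hc s hs
      simp only [hlam, hh] at h₂ he
      linarith
  obtain ⟨s, hs, hsmin⟩ := Finset.exists_min_image (maximizers v F (P + τ • toPlane u)) (dot u)
    ⟨s₁, (hmax s₁).2 ⟨hs₁A, hs₁c⟩⟩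
  have hs' := (hmax s').2 ⟨hs'A, hs'c⟩
  obtain ⟨hsA, hsc⟩ := (hmax s).1 hs
  have hst : h s < t := by
    have h₁ : ((dot u s : ℤ) : ℝ) ≤ (dot u s₁ : ℤ) := by
      exact_mod_cast hsmin s₁ ((hmax s₁).2 ⟨hs₁A, hs₁c⟩)
    have h₂ : h s ≤ h s₁ := by simp only [hh]; linarith
    linarith
  obtain ⟨b₀, hb₀A, hb₀, hb₀min, r₀, hr₀, r₀', hr₀', hrow₀, hrow₀', hext₀⟩ :=
    face_row_extent v hF huw hτ hs
  obtain ⟨b₁, hb₁A, hb₁, hb₁min, r₁, hr₁, r₁', hr₁', hrow₁, hrow₁', hext₁⟩ :=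
    face_row_extent v hF huw hτ hs'
  have hd : 0 < h s' - h s := by linarith
  set θ := (t - h s) / (h s' - h s) with hθ
  have hθ₀ : 0 ≤ θ := div_nonneg (by linarith) hd.le
  have hθ₁ : θ ≤ 1 := (div_le_one hd).2 (by linarith)
  have hθt : (1 - θ) * h s + θ * h s' = t := by
    have : θ * (h s' - h s) = t - h s := div_mul_cancel₀ _ hd.ne'
    linarith
  have hlam₀ : lam s ≤ lam b₀ := sub_le_sub_right hb₀ _
  have hlam₁ : lam s' ≤ lam b₁ := sub_le_sub_right hb₁ _
  -- On a line of slope -τ the value at s' is the smaller one, so its superlevel set contains that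
  -- of s.
  have hb₁₀ : dot u b₁ ≤ dot u b₀ := by
    refine hb₁min b₀ hb₀A ?_
    have : lam s' ≤ lam s := by nlinarith
    have := this.trans hlam₀
    simp only [hlam] at this
    linarith
  -- Otherwise the averaged lowest height lies beyond -y, where M is smaller than M(-y) ≤ M(t) ≤ c -
  -- τt. But c - τt is the average of λ at s and s', hence at most that at b₀ and b₁, and by
  -- concavity at most M at the averaged height.
  have hby : -((1 - θ) * h b₀ + θ * h b₁) ≤ y := by
    rcases hyB with hyB | hyM
    · have h₁ := mul_le_mul_of_nonneg_left (hB b₀ hb₀A) (sub_nonneg.2 hθ₁)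
      have h₂ := mul_le_mul_of_nonneg_left (hB b₁ hb₁A) hθ₀
      simp only [hh]
      linarith
    · by_contra! hlt
      have h₁ := hM.lt_of_lt hy0.le hlt
      rw [neg_neg] at h₁
      have h₂ := hM.concaveOn.2 (mem_univ (h b₀)) (mem_univ (h b₁)) (sub_nonneg.2 hθ₁) hθ₀
        (sub_add_cancel 1 θ)
      simp only [smul_eq_mul] at h₂
      have h₃ := mul_le_mul_of_nonneg_left (hlam₀.trans (hM.le_apply b₀ hb₀A)) (sub_nonneg.2 hθ₁)
      have h₄ := mul_le_mul_of_nonneg_left (hlam₁.trans (hM.le_apply b₁ hb₁A)) hθ₀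
      have h₅ : (1 - θ) * lam s + θ * lam s' = c - τ * t := by
        rw [← hθt]
        linear_combination (1 - θ) * hsc + θ * hs'c
      linarith
  have hext₀' : (m : ℝ) - h s + h b₀ ≤ (dot w r₀ : ℤ) - (dot w r₀' : ℤ) := by
    have : ((m - (dot u s - dot u b₀) : ℤ) : ℝ) ≤ ((dot w r₀ - dot w r₀' : ℤ) : ℝ) := by
      exact_mod_cast hext₀
    push_cast at this
    simp only [hh]
    linarith
  have hext₁' : (m : ℝ) - h s' + h b₁ ≤ (dot w r₁ : ℤ) - (dot w r₁' : ℤ) := by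
    have : ((m - (dot u s' - dot u b₁) : ℤ) : ℝ) ≤ ((dot w r₁ - dot w r₁' : ℤ) : ℝ) := by
      exact_mod_cast hext₁
    push_cast at this
    simp only [hh]
    linarith
  have hbb : h b₁ ≤ h b₀ := sub_le_sub_right (by exact_mod_cast hb₁₀) _
  -- If the lower row were a point, both extent bounds would be nonpositive, yet their average is at
  -- least m - t - y > 0.
  have hne : r₀ ≠ r₀' := by
    rintro rfl
    rw [sub_self] at hext₀'
    have h₁ : (1 - θ) * (m - h s + h b₀) + θ * (m - h s' + h b₁) ≤ 0 := by
      have h₂ : (m : ℝ) - h s' + h b₁ ≤ 0 := by linarith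
      have h₃ := mul_nonneg (sub_nonneg.2 hθ₁) (neg_nonneg.2 hext₀')
      have h₄ := mul_nonneg hθ₀ (neg_nonneg.2 h₂)
      linarith
    linarith
  have hss' : dot u s < dot u s' := by
    have : ((dot u s : ℤ) : ℝ) < (dot u s' : ℤ) := by
      simp only [hh] at hd
      linarith
    exact_mod_cast this
  have hface := maximizers_mem_influenceFaces v F hu hs hsmin hr₀ hrow₀ hr₀' hrow₀' hne hs' hss'
  have hslice := le_volume_slice (W := influenceRegion v F P) (w := w) (k := dot u a)
    (subset_biUnion_of_mem hface)
    hr₀ hr₀' hr₁ hr₁' (hrow₀'.trans hrow₀.symm) (hrow₁'.trans hrow₁.symm) hθ₀ hθ₁ (t := t)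
    (by rw [hrow₀, hrow₁]; exact hθt)
  refine le_trans (ENNReal.ofReal_le_ofReal ?_) hslice
  have h₁ := mul_le_mul_of_nonneg_left hext₀' (sub_nonneg.2 hθ₁)
  have h₂ := mul_le_mul_of_nonneg_left hext₁' hθ₀
  linarith

/-- Lattice coordinates preserve the area. -/
theorem volume_latticeCoordinates {u w : ℤ × ℤ} (hdet : |u.1 * w.2 - u.2 * w.1| = 1) (k : ℤ)
    {W : Set (ℝ × ℝ)} (hW : IsCompact W) :
    MeasurableSet {z : ℝ × ℝ | z.2 ∈ slice u w k W z.1} ∧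
      volume {z : ℝ × ℝ | z.2 ∈ slice u w k W z.1} = volume W := by
  set A : Matrix (Fin 2) (Fin 2) ℝ := !![(u.1 : ℝ), u.2; w.1, w.2] with hA
  set b := Module.Basis.finTwoProd ℝ
  set φ := Matrix.toLin b b A with hφ
  have hφapply : ∀ q : ℝ × ℝ, φ q = (u.1 * q.1 + u.2 * q.2, w.1 * q.1 + w.2 * q.2) := by
    rintro ⟨x, y⟩
    rw [hφ, hA]
    exact Matrix.toLin_finTwoProd_apply _ _ _ _ _
  have hset : {z : ℝ × ℝ | z.2 ∈ slice u w k W z.1} =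
      (fun z => z + ((k : ℝ), (0 : ℝ))) ⁻¹' (φ '' W) := by
    ext ⟨t, x⟩
    simp only [slice, mem_ofPred_eq, mem_preimage, mem_image, hφapply, Prod.mk_add_mk, add_zero,
      Prod.mk.injEq, sub_eq_iff_eq_add]
  have hcomp : IsCompact (φ '' W) := hW.image φ.continuous_of_finiteDimensional
  rw [hset]
  refine ⟨hcomp.measurableSet.preimage (measurable_add_const _), ?_⟩
  rw [measure_preimage_add_right, Measure.addHaar_image_linearMap, hφ, LinearMap.det_toLin, hA,
    Matrix.det_fin_two_of]
  have : |((u.1 : ℝ) * w.2 - u.2 * w.1)| = 1 := by exact_mod_cast hdet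
  rw [this]
  simp

/-! ### Integer length -/

/-- Needed because `Set.ncard` is 0 on infinite sets. -/
theorem finite_setOf_toPlane_mem_cellHull (S : Finset (ℤ × ℤ)) :
    {z : ℤ × ℤ | toPlane z ∈ cellHull S}.Finite := by
  obtain ⟨N, hN⟩ : ∃ N : ℤ, ∀ s ∈ S, |s.1| ≤ N ∧ |s.2| ≤ N :=
    ⟨∑ s ∈ S, (|s.1| + |s.2|), fun s hs => by
      have := Finset.single_le_sum (f := fun s : ℤ × ℤ => |s.1| + |s.2|)
        (fun s _ => by positivity) hs
      constructor <;> linarith [abs_nonneg s.1, abs_nonneg s.2]⟩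
  refine (Set.finite_Icc ((-N, -N) : ℤ × ℤ) (N, N)).subset fun z hz => ?_
  have hsub : cellHull S ⊆ Icc ((-N : ℝ), (-N : ℝ)) ((N : ℝ), (N : ℝ)) := by
    refine convexHull_min ?_ (convex_Icc _ _)
    rintro _ ⟨s, hs, rfl⟩
    obtain ⟨h₁, h₂⟩ := hN s hs
    rw [abs_le] at h₁ h₂
    refine ⟨⟨?_, ?_⟩, ⟨?_, ?_⟩⟩ <;> simp only [toPlane] <;> exact_mod_cast (by tauto)
  obtain ⟨⟨h₁, h₂⟩, h₃, h₄⟩ := hsub hz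
  simp only [toPlane] at h₁ h₂ h₃ h₄
  exact ⟨⟨by exact_mod_cast h₁, by exact_mod_cast h₂⟩, by exact_mod_cast h₃, by exact_mod_cast h₄⟩

theorem le_integerLength {S : Finset (ℤ × ℤ)} {e r r' : ℤ × ℤ} {m : ℕ} {k : ℤ} (he : e ≠ 0)
    (hr : r ∈ S) (hr' : r' ∈ S) (hrr' : r = r' + k • e) (hk : (m : ℤ) ≤ k) :
    m ≤ integerLength (cellHull S) := by
  have hinj : Function.Injective fun i : ℕ => r' + (i : ℤ) • e := by
    intro i j hij
    have h₁ : (i : ℤ) • e = (j : ℤ) • e := add_left_cancel hij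
    rcases Prod.ext_iff.not.1 he |> not_and_or.1 with h | h
    · have h₂ := congrArg Prod.fst h₁
      simp only [Prod.smul_fst, smul_eq_mul] at h₂
      exact_mod_cast mul_right_cancel₀ h h₂
    · have h₂ := congrArg Prod.snd h₁
      simp only [Prod.smul_snd, smul_eq_mul] at h₂
      exact_mod_cast mul_right_cancel₀ h h₂
  have hsub : ((Finset.range (m + 1)).image fun i : ℕ => r' + (i : ℤ) • e : Set (ℤ × ℤ)) ⊆
      {z : ℤ × ℤ | toPlane z ∈ cellHull S} := by
    intro z hz
    obtain ⟨i, hi, rfl⟩ := Finset.mem_image.1 (Finset.mem_coe.1 hz)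
    have him : (i : ℤ) ≤ k := by
      have := Finset.mem_range.1 hi
      omega
    rcases eq_or_ne k 0 with rfl | hk0
    · have hi0 : (i : ℤ) = 0 := by omega
      simpa [hi0] using toPlane_mem_cellHull hr'
    · have hkpos : (0 : ℝ) < k := by exact_mod_cast (by omega : 0 < k)
      have him' : (i : ℝ) ≤ k := by exact_mod_cast him
      have hconv := convex_convexHull ℝ _ (toPlane_mem_cellHull hr') (toPlane_mem_cellHull hr)
        (sub_nonneg.2 ((div_le_one hkpos).2 him')) (div_nonneg i.cast_nonneg hkpos.le)
        (sub_add_cancel 1 ((i : ℝ) / k))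
      have heq : (1 - (i : ℝ) / k) • toPlane r' + ((i : ℝ) / k) • toPlane r =
          toPlane (r' + (i : ℤ) • e) := by
        rw [hrr']
        ext <;>
        · simp only [toPlane, Prod.fst_add, Prod.snd_add, Prod.smul_fst, Prod.smul_snd,
            smul_eq_mul]
          push_cast
          field_simp
          ring
      rw [heq] at hconv
      exact hconv
  have hcard := Set.ncard_le_ncard hsub (finite_setOf_toPlane_mem_cellHull S)
  rw [Set.ncard_coe_finset, Finset.card_image_of_injective _ hinj, Finset.card_range] at hcard
  unfold integerLength
  omega

/-! ### Multiple points on an edge -/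

theorem exists_primitive_direction {a b : ℤ × ℤ} (hab : a ≠ b) :
    ∃ (g : ℤ) (e : ℤ × ℤ), g ≠ 0 ∧ IsCoprime e.1 e.2 ∧ b.1 - a.1 = g * e.1 ∧
      b.2 - a.2 = g * e.2 := by
  have hg : (Int.gcd (b.1 - a.1) (b.2 - a.2) : ℤ) ≠ 0 := by
    intro h0
    rw [Int.natCast_eq_zero, Int.gcd_eq_zero_iff] at h0
    exact hab (Prod.ext (by omega) (by omega))
  refine ⟨Int.gcd (b.1 - a.1) (b.2 - a.2), ((b.1 - a.1) / Int.gcd (b.1 - a.1) (b.2 - a.2),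
    (b.2 - a.2) / Int.gcd (b.1 - a.1) (b.2 - a.2)), hg, ?_,
    (Int.mul_ediv_cancel' (Int.gcd_dvd_left ..)).symm,
    (Int.mul_ediv_cancel' (Int.gcd_dvd_right ..)).symm⟩
  exact Int.isCoprime_iff_gcd_eq_one.2 (Int.gcd_ediv_gcd_ediv_gcd (by omega))

/-- If the maximal monomials at `Val(p)` lie in one row of a direction in which the width of the
exponents is at least `m`, then the influence of `Val(p)` is at least `m ^ 2 / 2`. -/
theorem half_sq_le_influence {F : Laurent K} {p : Kˣ × Kˣ} {m : ℕ}
    (hF : F ∈ pointIdeal p ^ m) {u w : ℤ × ℤ} (hdet : |u.1 * w.2 - u.2 * w.1| = 1)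
    (hwidth : m ≤ widthDir (exponents F) u) {a : ℤ × ℤ}
    (ha : a ∈ maximizers v F (valPoint v p))
    (hrow : ∀ s ∈ maximizers v F (valPoint v p), dot u s = dot u a) :
    (m : ℝ) ^ 2 / 2 ≤ influence v F (valPoint v p) := by
  classical
  have hu : u ≠ 0 := by
    rintro rfl
    simp at hdet
  have hdet0 : u.1 * w.2 - u.2 * w.1 ≠ 0 := fun h => by simp [h] at hdet
  have huw : ∀ s t, dot u s = dot u t → dot w s = dot w t → s = t := by
    intro s t h₁ h₂
    simp only [dot_apply] at h₁ h₂
    have h₃ : (u.1 * w.2 - u.2 * w.1) * (s.1 - t.1) = 0 := by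
      linear_combination w.2 * h₁ - u.2 * h₂
    have h₄ : (u.1 * w.2 - u.2 * w.1) * (s.2 - t.2) = 0 := by
      linear_combination u.1 * h₂ - w.1 * h₁
    exact Prod.ext (sub_eq_zero.1 ((mul_eq_zero.1 h₃).resolve_left hdet0))
      (sub_eq_zero.1 ((mul_eq_zero.1 h₄).resolve_left hdet0))
  have hneg : ∀ s, dot (-u) s = -dot u s := by
    intro s
    simp only [dot_apply, Prod.fst_neg, Prod.snd_neg]
    ring
  obtain ⟨haA, hamax⟩ := (mem_maximizers v F).1 ha
  have hlt : ∀ s ∈ exponents F, dot u s ≠ dot u a →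
      tropMonomial v F s (valPoint v p) < tropMonomial v F a (valPoint v p) := by
    intro s hs hne
    by_contra! hle
    exact hne (hrow s ((mem_maximizers v F).2 ⟨hs, fun t ht => (hamax t ht).trans hle⟩))
  set h : ℤ × ℤ → ℝ := fun s => ((dot u s : ℤ) : ℝ) - (dot u a : ℤ) with hh
  obtain ⟨M, hM⟩ := exists_isEnvelope (exponents F) h
    (fun s => tropMonomial v F s (valPoint v p) - tropMonomial v F a (valPoint v p))
    ⟨a, haA, sub_self _, sub_self _⟩ (fun s hs => sub_nonpos.2 (hamax s hs))
    (fun s hs hne => sub_neg.2 (hlt s hs fun he => hne (sub_eq_zero.2 (congrArg _ he))))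
  obtain ⟨s₁, hs₁, hs₁max⟩ := Finset.exists_max_image (exponents F) h ⟨a, haA⟩
  obtain ⟨s₂, hs₂, hs₂min⟩ := Finset.exists_min_image (exponents F) h ⟨a, haA⟩
  have hTB : (m : ℝ) ≤ h s₁ + -h s₂ := by
    obtain ⟨⟨x, y⟩, hxy, heq⟩ := Finset.exists_mem_eq_sup (exponents F ×ˢ exponents F)
      ⟨(a, a), Finset.mk_mem_product haA haA⟩ fun xy : (ℤ × ℤ) × (ℤ × ℤ) =>
        (u.1 * (xy.1.1 - xy.2.1) + u.2 * (xy.1.2 - xy.2.2)).toNat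
    obtain ⟨hx, hy⟩ := Finset.mem_product.1 hxy
    have h₁ : m ≤ (u.1 * (x.1 - y.1) + u.2 * (x.2 - y.2)).toNat := hwidth.trans heq.le
    have h₂ : u.1 * (x.1 - y.1) + u.2 * (x.2 - y.2) = dot u x - dot u y := by
      simp only [dot_apply]
      ring
    rw [h₂] at h₁
    have h₃ : (m : ℤ) ≤ max (dot u x - dot u y) 0 := by omega
    have h₄ : (m : ℝ) ≤ max (((dot u x : ℤ) : ℝ) - (dot u y : ℤ)) 0 := by exact_mod_cast h₃
    refine h₄.trans (max_le ?_ ?_)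
    · have h₅ := hs₁max x hx
      have h₆ := hs₂min y hy
      simp only [hh] at h₅ h₆ ⊢
      linarith
    · linarith [hs₁max a haA, hs₂min a haA]
  obtain ⟨hmeas, hvol⟩ := volume_latticeCoordinates hdet (dot u a)
    (isCompact_influenceRegion v F (valPoint v p))
  -- The heights of the rows are finitely many and may be ignored in the integral.
  have hae : ∀ g : ℤ × ℤ → ℝ, ∀ᵐ t : ℝ, ∀ s ∈ exponents F, g s ≠ t := by
    intro g
    filter_upwards [((exponents F).image g).finite_toSet.countable.ae_notMem volume]
      with t ht s hs hst
    exact ht (Finset.mem_coe.2 (Finset.mem_image.2 ⟨s, hs, hst⟩))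
  have hhneg : ∀ s, ((dot (-u) s : ℤ) : ℝ) - (dot (-u) a : ℤ) = -h s := by
    intro s
    simp only [hneg, hh]
    push_cast
    ring
  have key := half_sq_le_volume (m.cast_nonneg) hTB hM.continuous hmeas ?_ ?_
  · rw [hvol] at key
    have := key.trans (volume_influenceRegion_le v F (valPoint v p))
    rcases le_or_gt 0 (influence v F (valPoint v p)) with h0 | h0
    · exact (ENNReal.ofReal_le_ofReal_iff h0).1 this
    · rw [influence] at h0
      exact absurd h0 (not_lt.2 (Finset.sum_nonneg fun S _ => ENNReal.toReal_nonneg))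
  · filter_upwards [hae h] with t ht y hty
    exact le_volume_slice_influenceRegion v hF hu huw haA hlt hM ⟨s₁, hs₁, le_rfl⟩
      (fun s hs => neg_le_neg (hs₂min s hs)) ht hty
  · filter_upwards [hae fun s => -h s] with t ht y hty
    -- Negative heights: with -u for u, the extreme heights T and B change roles.
    have hslice := le_volume_slice_influenceRegion v hF (neg_ne_zero.2 hu) (w := w)
      (fun s t h₁ h₂ => huw s t (by rw [hneg, hneg] at h₁; exact neg_injective h₁) h₂) haA
      (fun s hs hne => hlt s hs fun he => hne (by rw [hneg, hneg, he]))
      (M := fun x => M (-x)) (by simpa only [hhneg] using hM.comp_neg)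
      (T := -h s₂) (B := h s₁) ⟨s₂, hs₂, (hhneg s₂).ge⟩
      (fun s hs => by rw [hhneg, neg_neg]; exact hs₁max s hs)
      (fun s hs => by rw [hhneg]; exact ht s hs) hty
    refine hslice.trans (measure_mono ?_)
    rintro x ⟨q, hq, hqt, hqx⟩
    refine ⟨q, hq, ?_, hqx⟩
    rw [hneg] at hqt
    simp only [Prod.fst_neg, Prod.snd_neg] at hqt
    push_cast at hqt ⊢
    linarith

end TropCurve

theorem theorem2 {K : Type*} [Field K] (v : Valuation K (WithZero (Multiplicative ℝ)))
    (F : TropCurve.Laurent K) (p : Kˣ × Kˣ) (m : ℕ)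
    (hmult : TropCurve.HasMultiplicity F p m)
    (hadm : m ≤ TropCurve.latticeWidth (TropCurve.exponents F))
    (E : Set (ℝ × ℝ)) (hE : TropCurve.IsEdge v F E)
    (hPE : TropCurve.valPoint v p ∈ E)
    (hP : ¬ TropCurve.IsVertex v F (TropCurve.valPoint v p)) :
    (m : ℝ) ^ 2 / 2 ≤ TropCurve.influence v F (TropCurve.valPoint v p) ∧
      m ≤ TropCurve.integerLength (TropCurve.cellHull (TropCurve.dualCell v F E)) := by
  open TropCurve in
  obtain ⟨Q₀, ⟨a, ha₀, b, hb₀, hab⟩, -, rfl⟩ := hE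
  replace hPE : maximizers v F Q₀ ⊆ maximizers v F (valPoint v p) := hPE
  have ha := hPE ha₀
  have hb := hPE hb₀
  obtain ⟨haA, hamax⟩ := (mem_maximizers v F).1 ha
  obtain ⟨hbA, hbmax⟩ := (mem_maximizers v F).1 hb
  obtain ⟨g, e, hg, ⟨x, y, hxy⟩, h₁, h₂⟩ := exists_primitive_direction hab
  have he : e ≠ 0 := by
    rintro rfl
    simp at hxy
  -- u is constant along e, and the Bézout coefficients give a w with value 1 on e, so w counts
  -- lattice steps in a row.
  set u : ℤ × ℤ := (-e.2, e.1) with hu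
  set w : ℤ × ℤ := (x, y) with hw
  have hdet : |u.1 * w.2 - u.2 * w.1| = 1 := by
    rw [show u.1 * w.2 - u.2 * w.1 = -1 by simp only [hu, hw]; linarith]
    rfl
  have hrow : ∀ s ∈ maximizers v F (valPoint v p), dot u s = dot u a := by
    intro s hs
    have hcross := cross_eq_of_collinear (not_not.1 hP) ha hb hs
    rw [h₁, h₂] at hcross
    refine mul_left_cancel₀ hg ?_
    simp only [dot_apply, hu]
    linear_combination hcross
  have hmultiple : ∀ s t, dot u s = dot u t → s = t + (dot w s - dot w t) • e := by
    intro s t hst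
    simp only [dot_apply, hu, hw] at hst ⊢
    ext
    · simp only [Prod.fst_add, Prod.smul_fst, smul_eq_mul]
      linear_combination (t.1 - s.1) * hxy - y * hst
    · simp only [Prod.snd_add, Prod.smul_snd, smul_eq_mul]
      linear_combination (t.2 - s.2) * hxy + x * hst
  refine ⟨half_sq_le_influence v hmult.1 hdet (hadm.trans (Nat.sInf_le ⟨u, ?_, rfl⟩)) ha hrow, ?_⟩
  · intro h0
    rw [Prod.ext_iff] at h0
    simp only [hu, Prod.fst_zero, Prod.snd_zero, neg_eq_zero] at h0
    exact he (Prod.ext h0.2 h0.1)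
  -- Since P is not a vertex, its maximal monomials are collinear along e. For R in E, R - P is
  -- orthogonal to e, so they stay tied along E.
  have hdual : ∀ s ∈ maximizers v F (valPoint v p),
      s ∈ dualCell v F {R | maximizers v F Q₀ ⊆ maximizers v F R} := by
    intro s hs
    obtain ⟨hsA, hsmax⟩ := (mem_maximizers v F).1 hs
    refine (mem_dualCell v F).2 ⟨hsA, fun R hR => ?_⟩
    obtain ⟨-, haR⟩ := (mem_maximizers v F).1 (hR ha₀)
    obtain ⟨-, hbR⟩ := (mem_maximizers v F).1 (hR hb₀)
    refine (mem_maximizers v F).2 ⟨hsA, fun t ht => (haR t ht).trans (le_of_eq ?_)⟩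
    have h₃ := le_antisymm (haR b hbA) (hbR a haA)
    have h₄ := le_antisymm (hamax b hbA) (hbmax a haA)
    have h₅ := le_antisymm (hamax s hsA) (hsmax a haA)
    have hg' : (g : ℝ) ≠ 0 := Int.cast_ne_zero.2 hg
    have h₁' : (b.1 : ℝ) - a.1 = g * e.1 := by exact_mod_cast h₁
    have h₂' : (b.2 : ℝ) - a.2 = g * e.2 := by exact_mod_cast h₂
    set k := dot w s - dot w a
    have hs₁ := congrArg Prod.fst (hmultiple s a (hrow s hs))
    have hs₂ := congrArg Prod.snd (hmultiple s a (hrow s hs))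
    simp only [Prod.fst_add, Prod.smul_fst, Prod.snd_add, Prod.smul_snd, smul_eq_mul] at hs₁ hs₂
    have hs₁' : (s.1 : ℝ) = a.1 + k * e.1 := by exact_mod_cast hs₁
    have hs₂' : (s.2 : ℝ) = a.2 + k * e.2 := by exact_mod_cast hs₂
    set P := valPoint v p
    have horth : (e.1 : ℝ) * (R.1 - P.1) + e.2 * (R.2 - P.2) = 0 := by
      refine (mul_eq_zero.1 ?_).resolve_left hg'
      simp only [tropMonomial] at h₃ h₄
      linear_combination h₃ - h₄ - (R.1 - P.1) * h₁' - (R.2 - P.2) * h₂'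
    simp only [tropMonomial] at h₅ ⊢
    linear_combination -h₅ - k * horth - (R.1 - P.1) * hs₁' - (R.2 - P.2) * hs₂'
  obtain ⟨r, hr, r', hr', har, har', hrr, hrr', hext⟩ := row_extent v hmult.1 (u := u) (w := w)
    (fun s t hst hst' => by
      rw [hmultiple s t hst, hst', sub_self, zero_smul, add_zero]) haA
    (α := dot u a) (β := dot u a) fun s hs hle => by
      rw [hrow s ((mem_maximizers v F).2 ⟨hs, fun t ht => (hamax t ht).trans hle⟩)]
      exact ⟨le_rfl, le_rfl⟩
  rw [sub_self, sub_zero] at hext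
  exact le_integerLength he
    (hdual r ((mem_maximizers v F).2 ⟨hr, fun t ht => (hamax t ht).trans har⟩))
    (hdual r' ((mem_maximizers v F).2 ⟨hr', fun t ht => (hamax t ht).trans har'⟩))
    (hmultiple r r' (hrr.trans hrr'.symm)) hext
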